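/- Let $N,k\ge 0$ be integers, $1<p<\infty$, $1/p+1/p'=1$, and let $\mu,\nu$ be Radon measures on $\mathbb R^N$ without common atoms. *Definitions.* A *singular kernel* (with values in $\mathbb R^k$) is a $\mu\times\nu$-measurable function $K(s,t)$ on $\mathbb R^N\times\mathbb R^N$ ($t$ carrying $\mu$, $s$ carrying $\nu$) that is locally $L^2(\mu\times\nu)$ off the diagonal $\{s=t\}$. It is *restrictedly $L^p$ bounded with bound $C$* if $$\Big|\iint K(s,t)f(t)g(s)\,d\mu(t)\,d\nu(s)\Big|\le C\,\|f\|_{L^p(\mu)}\|g\|_{L^{p'}(\nu)}$$ for all bounded Borel functions $f,g$ with compact supports at positive distance from each other. A $d\times k$ matrix-valued function $M(s,t)$ is a *Schur multiplier with Schur norm at most $C_1$* if, for every $\mathbb R^k$-valued singular kernel $L$ that is restrictedly $L^p$ bounded with bound $C$, the product $ML$ is a singular kernel that is restrictedly $L^p$ bounded with bound $C_1C$. A function $H$ with values in $\mathbb R^d$ is *$\kappa$-sectorial* on a set $S$ if there is $x_0\in\mathbb R^d$, $|x_0|=1$, with $\langle H,x_0\rangle\ge\kappa|H|$ on $S$.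 Kernels and conditions on them are understood up to sets of $\mu\times\nu$-measure zero. *Hypothesis (H) on $K$.* There are $d\in\mathbb N$, $\delta>0$, $\kappa>0$, $C_1<\infty$ and $d\times k$ matrix-valued Schur multipliers $M_\varepsilon(s,t)$, $\varepsilon\in(0,\infty)$, of Schur norm at most $C_1$, such that for each $\varepsilon>0$, on the set $\{(s,t):(1-\delta)\varepsilon<|s-t|<\varepsilon\}$, the function $M_\varepsilon K$ is $\kappa$-sectorial and $|M_\varepsilon K|\ge|K|$. *Proposition.* (a) Let $K$ be a singular kernel with values in $\mathbb R^k$ that is restrictedly $L^p$ bounded and satisfies (H). Then the truncated operators $$T_\varepsilon f(s)=\int_{|s-t|>\varepsilon}K(s,t)f(t)\,d\mu(t),\qquad \varepsilon>0,$$ are uniformly bounded from $L^p(\mu)$ to $L^p(\nu)$: there is $C<\infty$ such that for every $\varepsilon>0$ and every bounded Borel function $f$ with compact support the integral converges absolutely for $\nu$-a.e. $s$, and $\|T_\varepsilon f\|_{L^p(\nu)}\le C\|f\|_{L^p(\mu)}$. (b) The generalized vector Riesz kernels $K(s,t)=(t-s)/|t-s|^{\alpha+1}$ in $\mathbb R^N$,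 $\alpha>0$, and, on $\mathbb C=\mathbb R^2$ with values in $\mathbb C=\mathbb R^2$, the Cauchy kernel $1/(t-s)$ and the Ahlfors–Beurling kernel $1/(t-s)^2$ are singular kernels satisfying (H) for all such $p,\mu,\nu$. Hence, if one of them is restrictedly $L^p$ bounded, its truncated operators $T_\varepsilon$ are uniformly bounded from $L^p(\mu)$ to $L^p(\nu)$. -/

import Mathlib

open MeasureTheory
open scoped NNReal ENNReal

noncomputable section

namespace SingularKernels

section Kernels

variable {E : Type*} [MetricSpace E] [MeasurableSpace E]
variable {F : Type*} [NormedAddCommGroup F] [NormedSpace ℝ F]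
variable {G : Type*} [NormedAddCommGroup G] [NormedSpace ℝ G]

/-- The measures have no common atoms. -/
def NoCommonAtoms (μ ν : Measure E) : Prop :=
  ∀ x : E, μ {x} = 0 ∨ ν {x} = 0

/-- Bounded Borel functions with compact support. -/
def IsTestFunction (f : E → ℝ) : Prop :=
  Measurable f ∧ (∃ B : ℝ, ∀ x, |f x| ≤ B) ∧ HasCompactSupport f

/-- The (closed) supports of `f` and `g` have positive distance. -/
def HaveSeparatedSupports (f g : E → ℝ) : Prop :=
  ∃ r : ℝ, 0 < r ∧ ∀ x ∈ tsupport f, ∀ y ∈ tsupport g, r ≤ dist x y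

/-- Singular kernel `K(s, t)`, where `t` is integrated against `μ` and `s` against `ν`:
a measurable function (up to null sets of the product measure) which is locally `L²`
off the diagonal, i.e. `L²` on every compact set that does not meet the diagonal. -/
def IsSingularKernel (K : E → E → F) (μ ν : Measure E) : Prop :=
  AEStronglyMeasurable (fun z : E × E => K z.1 z.2) (ν.prod μ) ∧
    ∀ Q : Set (E × E), IsCompact Q → Disjoint Q (Set.diagonal E) →
      MemLp (fun z : E × E => K z.1 z.2) 2 ((ν.prod μ).restrict Q)

/-- `C` is a restricted `L^p` bound of `K`:
`|∫ K(s, t) f(t) g(s) dμ(t) dν(s)| ≤ C ‖f‖_{L^p(μ)} ‖g‖_{L^{p'}(ν)}` for all bounded `f`, `g`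
with separated compact supports, `1 / p + 1 / p' = 1`. (For singular kernels the integrand
is integrable.) -/
def HasRestrictedBound (K : E → E → F) (p : ℝ) (μ ν : Measure E) (C : ℝ≥0) : Prop :=
  ∀ f g : E → ℝ, IsTestFunction f → IsTestFunction g → HaveSeparatedSupports f g →
    ‖∫ z : E × E, (f z.2 * g z.1) • K z.1 z.2 ∂(ν.prod μ)‖ ≤
      C * (eLpNorm f (ENNReal.ofReal p) μ).toReal *
        (eLpNorm g (ENNReal.ofReal p.conjExponent) ν).toReal

/-- `K` is restrictedly bounded in `L^p`. -/
def IsRestrictedlyBounded (K : E → E → F) (p : ℝ) (μ ν : Measure E) : Prop :=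
  ∃ C : ℝ≥0, HasRestrictedBound K p μ ν C

/-- The pointwise product of a matrix-valued (i.e. linear-map-valued) function and a
vector-valued kernel. -/
def schurProduct (M : E → E → F →L[ℝ] G) (K : E → E → F) : E → E → G :=
  fun s t => M s t (K s t)

/-- `M` is a Schur multiplier on the restrictedly `L^p` bounded singular kernels,
with Schur norm at most `C₁`. -/
def IsSchurMultiplierWith (M : E → E → F →L[ℝ] G) (p : ℝ) (μ ν : Measure E) (C₁ : ℝ≥0) : Prop :=
  ∀ (K : E → E → F) (C : ℝ≥0), IsSingularKernel K μ ν → HasRestrictedBound K p μ ν C →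
    IsSingularKernel (schurProduct M K) μ ν ∧
      HasRestrictedBound (schurProduct M K) p μ ν (C₁ * C)

/-- The truncated operator `T_ε f(s) = ∫_{|s - t| > ε} K(s, t) f(t) dμ(t)`. -/
def truncatedOperator (K : E → E → F) (μ : Measure E) (ε : ℝ) (f : E → ℝ) (s : E) : F :=
  ∫ t in {t : E | ε < dist s t}, f t • K s t ∂μ

/-- The truncated operators `T_ε`, `ε > 0`, are uniformly bounded `L^p(μ) → L^p(ν)`. As usual
they are defined on the dense class of bounded compactly supported functions, where the
defining integral has to converge absolutely for `ν`-almost every `s`. -/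
def TruncationsUniformlyBounded (K : E → E → F) (p : ℝ) (μ ν : Measure E) : Prop :=
  ∃ C : ℝ≥0, ∀ ε : ℝ, 0 < ε → ∀ f : E → ℝ, IsTestFunction f →
    (∀ᵐ s ∂ν, IntegrableOn (fun t => f t • K s t) {t : E | ε < dist s t} μ) ∧
    MemLp (truncatedOperator K μ ε f) (ENNReal.ofReal p) ν ∧
    eLpNorm (truncatedOperator K μ ε f) (ENNReal.ofReal p) ν ≤
      C * eLpNorm f (ENNReal.ofReal p) μ

/-- The set of pairs with `(1 - δ) ε < |s - t| < ε`. -/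
def annulus (E : Type*) [MetricSpace E] (δ ε : ℝ) : Set (E × E) :=
  {z | (1 - δ) * ε < dist z.1 z.2 ∧ dist z.1 z.2 < ε}

end Kernels

/-- The function `H` is `κ`-sectorial on `S` (for functions defined up to `m`-null sets):
there is a unit vector `x₀` with `⟨H, x₀⟩ ≥ κ |H|` on `S`. -/
def IsSectorialOn {X : Type*} [MeasurableSpace X] {G : Type*} [NormedAddCommGroup G]
    [InnerProductSpace ℝ G] (κ : ℝ) (H : X → G) (S : Set X) (m : Measure X) : Prop :=
  ∃ x₀ : G, ‖x₀‖ = 1 ∧ ∀ᵐ z ∂m, z ∈ S → κ * ‖H z‖ ≤ inner ℝ (H z) x₀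

/-- There are `δ, κ > 0` and uniformly bounded matrix-valued Schur multipliers `M_ε`, `ε > 0`,
such that on the pairs with `(1 - δ) ε < |s - t| < ε` the function `M_ε K` is `κ`-sectorial
and satisfies `|M_ε K| ≥ |K|`. -/
def HasSectorialMultipliers {E : Type*} [MetricSpace E] [MeasurableSpace E]
    {F : Type*} [NormedAddCommGroup F] [NormedSpace ℝ F]
    (K : E → E → F) (p : ℝ) (μ ν : Measure E) : Prop :=
  ∃ (d : ℕ) (M : ℝ → E → E → F →L[ℝ] EuclideanSpace ℝ (Fin d)) (δ κ : ℝ) (C₁ : ℝ≥0),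
    0 < δ ∧ 0 < κ ∧ ∀ ε : ℝ, 0 < ε →
      IsSchurMultiplierWith (M ε) p μ ν C₁ ∧
      IsSectorialOn κ (fun z : E × E => schurProduct (M ε) K z.1 z.2)
        (annulus E δ ε) (ν.prod μ) ∧
      ∀ᵐ z ∂(ν.prod μ), z ∈ annulus E δ ε → ‖K z.1 z.2‖ ≤ ‖schurProduct (M ε) K z.1 z.2‖

/-- The generalized vector Riesz kernel `(t - s) / |t - s|^(α + 1)` in `ℝ^N`. -/
def rieszKernel (N : ℕ) (α : ℝ) (s t : EuclideanSpace ℝ (Fin N)) : EuclideanSpace ℝ (Fin N) :=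
  (‖t - s‖ ^ (α + 1))⁻¹ • (t - s)

/-- The Cauchy kernel `1 / (t - s)` in `ℂ`. -/
def cauchyKernel (s t : ℂ) : ℂ := 1 / (t - s)

/-- The Ahlfors-Beurling kernel `1 / (t - s)²` in `ℂ`. -/
def ahlforsBeurlingKernel (s t : ℂ) : ℂ := 1 / (t - s) ^ 2

end SingularKernels

end

open Filter Topology

set_option linter.unusedSectionVars false

namespace SingularKernels

/-! ### Test functions and their stability under products, restrictions and absolute values. -/

section TestFunctions

variable {E : Type*} [MetricSpace E] [MeasurableSpace E] [BorelSpace E]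

/-! The sharp cutoff at `ε` is replaced by a smooth one, and the error is controlled by positivity.

Smooth cutoffs: by Fourier inversion, a smooth compactly supported function of `(t - s) / ε` is a
superposition of characters of `t - s`. Each character splits into products of bounded functions of
`t` and of `s`, which are absorbed into `f` and `g`. The multiplier norm is therefore controlled by
an `L¹` norm of the Fourier transform, independent of `ε` (`exists_forall_isSchurMultiplierWith`).

Separation of supports: for a kernel vanishing near the diagonal, the bound extends to all test
functions (`HasRestrictedBound.norm_integral_le`). Cut space into small cells and put each cell at
random on the side of `f` or of `g`. Two points in different cells end up on the prescribed sides
with probability 1/4, and two points in one cell see a zero kernel, so averaging costs a factor 4.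

Sharp cutoffs: the sharp and the smooth truncation differ only on a thin shell, by at most `|K|`.
There `|K|` is dominated by a smoothly localised `M_ρ K`, which is sectorial: its norm is at most
`κ⁻¹` times its component along `x₀`. That component is a nonnegative kernel with a bilinear bound,
so it controls every kernel it dominates (`norm_integral_le_of_norm_le_sectorial`). Duality then
turns the bilinear bound into an operator bound.

For the concrete kernels, pairing with the vector field `x` or the conjugate of `x ^ n`, rescaled
and cut off, makes the kernel a positive scalar. -/

lemma IsTestFunction.memLp {f : E → ℝ} (hf : IsTestFunction f) (q : ℝ≥0∞) (μ : Measure E)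
    [IsLocallyFiniteMeasure μ] : MemLp f q μ := by
  obtain ⟨hm, ⟨B, hB⟩, hc⟩ := hf
  have hfin : μ (tsupport f) ≠ ∞ := (IsCompact.measure_lt_top hc).ne
  have h1 : MemLp ((tsupport f).indicator fun _ : E => B) q μ :=
    memLp_indicator_const q (isClosed_tsupport f).measurableSet B (Or.inr hfin)
  refine h1.mono hm.aestronglyMeasurable (ae_of_all _ fun x => ?_)
  by_cases hx : x ∈ tsupport f
  · rw [Set.indicator_of_mem hx]
    exact (hB x).trans (le_abs_self B)
  · rw [image_eq_zero_of_notMem_tsupport hx]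
    simp

lemma IsTestFunction.mul {f u : E → ℝ} (hf : IsTestFunction f) (hu : Measurable u) {c : ℝ}
    (hc : ∀ x, |u x| ≤ c) : IsTestFunction fun x => f x * u x := by
  obtain ⟨hm, ⟨B, hB⟩, hs⟩ := hf
  refine ⟨hm.mul hu, ⟨B * c, fun x => ?_⟩, hs.mul_right⟩
  rw [abs_mul]
  exact mul_le_mul (hB x) (hc x) (abs_nonneg _) ((abs_nonneg _).trans (hB x))

lemma IsTestFunction.indicator {f : E → ℝ} (hf : IsTestFunction f) {A : Set E}
    (hA : MeasurableSet A) : IsTestFunction (A.indicator f) := by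
  obtain ⟨hm, ⟨B, hB⟩, hs⟩ := hf
  refine ⟨hm.indicator hA, ⟨B, fun x => ?_⟩, hs.mono fun x hx h0 => hx (by simp [h0])⟩
  exact (norm_indicator_le_norm_self f x).trans (hB x)

lemma IsTestFunction.abs {f : E → ℝ} (hf : IsTestFunction f) : IsTestFunction fun x => |f x| := by
  obtain ⟨hm, ⟨B, hB⟩, hs⟩ := hf
  exact ⟨hm.abs, ⟨B, fun x => by simpa using hB x⟩, hs.comp_left abs_zero⟩

lemma tsupport_mul_subset {f u : E → ℝ} : tsupport (fun x => f x * u x) ⊆ tsupport f :=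
  closure_mono fun x hx hx0 => hx (by simp [hx0])

end TestFunctions

/-! ### Absolute convergence of the bilinear pairing. -/

section Integrability

variable {E : Type*} [NormedAddCommGroup E] [InnerProductSpace ℝ E] [FiniteDimensional ℝ E]
  [MeasurableSpace E] [BorelSpace E]
variable {F : Type*} [NormedAddCommGroup F] [NormedSpace ℝ F]
variable {K : E → E → F} {μ ν : Measure E} [IsLocallyFiniteMeasure μ] [IsLocallyFiniteMeasure ν]

lemma integrable_pairing_of_integrableOn {f g : E → ℝ} (hf : IsTestFunction f)
    (hg : IsTestFunction g)
    (hK : IntegrableOn (fun z : E × E => K z.1 z.2) (tsupport g ×ˢ tsupport f) (ν.prod μ)) :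
    Integrable (fun z : E × E => (f z.2 * g z.1) • K z.1 z.2) (ν.prod μ) := by
  obtain ⟨hfm, ⟨A, hA⟩, hfs⟩ := hf
  obtain ⟨hgm, ⟨B, hB⟩, hgs⟩ := hg
  have hQ : MeasurableSet (tsupport g ×ˢ tsupport f) :=
    (isClosed_tsupport g).measurableSet.prod (isClosed_tsupport f).measurableSet
  have h0 : (fun z : E × E => (f z.2 * g z.1) • K z.1 z.2) =
      (tsupport g ×ˢ tsupport f).indicator (fun z : E × E => (f z.2 * g z.1) • K z.1 z.2) := by
    ext z
    by_cases hz : z ∈ tsupport g ×ˢ tsupport f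
    · rw [Set.indicator_of_mem hz]
    · rw [Set.indicator_of_notMem hz]
      rw [Set.mem_prod, not_and_or] at hz
      rcases hz with hz | hz <;> simp [image_eq_zero_of_notMem_tsupport hz]
  rw [h0, integrable_indicator_iff hQ]
  have hm : Measurable fun z : E × E => f z.2 * g z.1 :=
    (hfm.comp measurable_snd).mul (hgm.comp measurable_fst)
  refine Integrable.bdd_smul ?_ (A * B) hm.aestronglyMeasurable (ae_of_all _ fun z => ?_)
  · exact hK
  · rw [norm_mul]
    exact mul_le_mul (hA _) (hB _) (abs_nonneg _) ((abs_nonneg _).trans (hA 0))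

lemma IsSingularKernel.integrableOn (hK : IsSingularKernel K μ ν) {Q : Set (E × E)}
    (hQ : IsCompact Q) (hd : Disjoint Q (Set.diagonal E)) :
    IntegrableOn (fun z : E × E => K z.1 z.2) Q (ν.prod μ) := by
  have : IsFiniteMeasure ((ν.prod μ).restrict Q) := ⟨by simpa using hQ.measure_lt_top⟩
  exact (hK.2 Q hQ hd).integrable one_le_two

lemma HaveSeparatedSupports.disjoint_diagonal {f g : E → ℝ} (h : HaveSeparatedSupports f g) :
    Disjoint (tsupport g ×ˢ tsupport f) (Set.diagonal E) := by
  obtain ⟨r, hr, h⟩ := h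
  rw [Set.disjoint_left]
  rintro ⟨s, t⟩ ⟨hs, ht⟩ (rfl : s = t)
  have := h s ht s hs
  rw [dist_self] at this
  exact hr.not_ge this

lemma IsSingularKernel.integrable_pairing (hK : IsSingularKernel K μ ν) {f g : E → ℝ}
    (hf : IsTestFunction f) (hg : IsTestFunction g) (hfg : HaveSeparatedSupports f g) :
    Integrable (fun z : E × E => (f z.2 * g z.1) • K z.1 z.2) (ν.prod μ) :=
  integrable_pairing_of_integrableOn hf hg
    (hK.integrableOn (IsCompact.prod hg.2.2 hf.2.2) hfg.disjoint_diagonal)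

lemma integrable_pairing_of_locallyIntegrable
    (hK : LocallyIntegrable (fun z : E × E => K z.1 z.2) (ν.prod μ)) {f g : E → ℝ}
    (hf : IsTestFunction f) (hg : IsTestFunction g) :
    Integrable (fun z : E × E => (f z.2 * g z.1) • K z.1 z.2) (ν.prod μ) :=
  integrable_pairing_of_integrableOn hf hg
    (hK.integrableOn_isCompact (IsCompact.prod hg.2.2 hf.2.2))

/-- A compact set meets the region where the kernel can be nonzero in a compact set off the
diagonal, where `L²` control is available. Pairings with arbitrary test functions then converge. -/
lemma IsSingularKernel.locallyIntegrable (hK : IsSingularKernel K μ ν) {r : ℝ} (hr : 0 < r)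
    (h0 : ∀ s t, dist s t < r → K s t = 0) :
    LocallyIntegrable (fun z : E × E => K z.1 z.2) (ν.prod μ) := by
  rw [locallyIntegrable_iff]
  intro Q hQ
  have hS : IsClosed {z : E × E | r ≤ dist z.1 z.2} :=
    isClosed_le continuous_const (continuous_fst.dist continuous_snd)
  have h1 := hK.integrableOn (hQ.inter_right hS) (by
    rw [Set.disjoint_left]
    rintro ⟨s, t⟩ ⟨-, hs⟩ (rfl : s = t)
    simp only [Set.mem_ofPred_eq, dist_self] at hs
    exact hr.not_ge hs)
  refine h1.of_forall_sdiff_eq_zero hQ.measurableSet fun z hz => h0 _ _ ?_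
  by_contra hlt
  exact hz.2 ⟨hz.1, not_lt.1 hlt⟩

lemma IsSingularKernel.of_norm_le {G : Type*} [NormedAddCommGroup G] [NormedSpace ℝ G]
    (hK : IsSingularKernel K μ ν) {K' : E → E → G}
    (hm : AEStronglyMeasurable (fun z : E × E => K' z.1 z.2) (ν.prod μ)) {c : ℝ}
    (hle : ∀ s t, ‖K' s t‖ ≤ c * ‖K s t‖) : IsSingularKernel K' μ ν :=
  ⟨hm, fun Q hQ hd => (hK.2 Q hQ hd).of_le_mul hm.restrict (ae_of_all _ fun z => hle z.1 z.2)⟩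

end Integrability

/-! ### Compact exhaustion and finite partitions into small cells. -/

section Regularity

lemma exists_monotone_isCompact_measure_sdiff_iUnion {X : Type*} [TopologicalSpace X] [T2Space X]
    [MeasurableSpace X] [OpensMeasurableSpace X] {μ : Measure X} [μ.InnerRegularCompactLTTop]
    {A : Set X} (hA : MeasurableSet A) (hμA : μ A ≠ ∞) :
    ∃ a : ℕ → Set X, Monotone a ∧ (∀ n, IsCompact (a n)) ∧ (∀ n, a n ⊆ A) ∧
      μ (A \ ⋃ n, a n) = 0 := by
  have h := fun n : ℕ => hA.exists_isCompact_sdiff_lt hμA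
    (ENNReal.inv_ne_zero.2 (ENNReal.natCast_ne_top (n + 1)))
  choose k hkA hkc hkμ using h
  refine ⟨Set.accumulate k, Set.monotone_accumulate, isCompact_accumulate hkc,
    fun n => Set.iUnion₂_subset fun m _ => hkA m, ?_⟩
  rw [Set.iUnion_accumulate]
  refine le_antisymm (ge_of_tendsto' (ENNReal.tendsto_inv_nat_nhds_zero.comp
    (tendsto_add_atTop_nat 1)) fun n => ?_) bot_le
  exact (measure_mono (Set.sdiff_subset_sdiff_right (Set.subset_iUnion k n))).trans (hkμ n).le

/-- Among all subsets of a finite type, a quarter contains one given point and misses another. -/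
lemma four_mul_card_filter_mem_notMem {J : Type*} [Fintype J] [DecidableEq J] {i j : J}
    (hij : i ≠ j) :
    4 * (Finset.univ.filter fun S : Finset J => i ∈ S ∧ j ∉ S).card = 2 ^ Fintype.card J := by
  have h : (Finset.univ.filter fun S : Finset J => i ∈ S ∧ j ∉ S) = Finset.Icc {i} {j}ᶜ := by
    ext S
    simp [Finset.mem_Icc]
  have hc : 1 < Fintype.card J := Fintype.one_lt_card_iff.2 ⟨i, j, hij⟩
  rw [h, Finset.card_Icc_finset (by simpa using hij.symm), Finset.card_compl]
  simp only [Finset.card_singleton]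
  obtain ⟨n, hn⟩ : ∃ n, Fintype.card J = n + 2 := ⟨_, (Nat.sub_add_cancel hc).symm⟩
  rw [hn, show n + 2 - 1 - 1 = n by omega, pow_add]
  ring

/-- A compact set has a finite Borel partition into pieces of small diameter. -/
lemma exists_finite_index_of_isCompact {X : Type*} [MetricSpace X] [MeasurableSpace X]
    [OpensMeasurableSpace X] {Q : Set X} (hQ : IsCompact Q) {r : ℝ} (hr : 0 < r) :
    ∃ (n : ℕ) (ι : X → (Fin n → Bool)), (∀ S : Set (Fin n → Bool), MeasurableSet (ι ⁻¹' S)) ∧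
      ∀ x ∈ Q, ∀ y, ι x = ι y → dist x y < r := by
  classical
  obtain ⟨T, -, hTf, hT⟩ := hQ.finite_cover_balls (half_pos hr)
  obtain ⟨n, ⟨e⟩⟩ := hTf.exists_equiv_fin
  let c : Fin n → X := fun i => e.symm i
  -- The cell of `x` records which of the covering balls contain it. Two points with the same record
  -- share a ball of radius `r / 2` as soon as one of them lies in `Q`.
  refine ⟨n, fun x i => decide (x ∈ Metric.ball (c i) (r / 2)), fun S => ?_, fun x hx y hxy => ?_⟩
  · have hS : Measurable fun x (i : Fin n) => decide (x ∈ Metric.ball (c i) (r / 2)) :=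
      measurable_pi_lambda _ fun i => measurable_to_bool (by
        convert (Metric.isOpen_ball (x := c i) (ε := r / 2)).measurableSet using 1
        ext x
        simp)
    exact hS S.to_countable.measurableSet
  · obtain ⟨z, hz, hxz⟩ := Set.mem_iUnion₂.1 (hT hx)
    have hi := congrFun hxy (e ⟨z, hz⟩)
    simp only [c, Equiv.symm_apply_apply, decide_eq_decide, Metric.mem_ball] at hi hxz
    have := hi.1 hxz
    linarith [dist_triangle_right x y z]

end Regularity

/-! ### Removing the separation of supports. -/

section Pairing

variable {E : Type*} [NormedAddCommGroup E] [InnerProductSpace ℝ E] [FiniteDimensional ℝ E]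
  [MeasurableSpace E] [BorelSpace E]
variable {F : Type*} [NormedAddCommGroup F] [NormedSpace ℝ F]
variable {K : E → E → F} {p : ℝ} {μ ν : Measure E} [IsLocallyFiniteMeasure μ]
  [IsLocallyFiniteMeasure ν] {C : ℝ≥0}

lemma toReal_eLpNorm_le_of_abs_le {f f' : E → ℝ} (hf : IsTestFunction f) (h : ∀ x, |f' x| ≤ |f x|)
    (q : ℝ≥0∞) : (eLpNorm f' q μ).toReal ≤ (eLpNorm f q μ).toReal :=
  ENNReal.toReal_mono (hf.memLp q μ).eLpNorm_ne_top (eLpNorm_mono h)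

/-- Disjoint sets need not be at positive distance, but disjoint compact subsets are. Inner
regularity exhausts both sets by such compacts up to null sets, and dominated convergence, available
because the kernel is locally integrable, passes to the limit. -/
lemma HasRestrictedBound.norm_integral_indicator_le (hC : HasRestrictedBound K p μ ν C)
    (hK : LocallyIntegrable (fun z : E × E => K z.1 z.2) (ν.prod μ)) {f g : E → ℝ}
    (hf : IsTestFunction f) (hg : IsTestFunction g) {A B : Set E} (hA : MeasurableSet A)
    (hB : MeasurableSet B) (hAB : Disjoint A B) :
    ‖∫ z : E × E, (A.indicator f z.2 * B.indicator g z.1) • K z.1 z.2 ∂(ν.prod μ)‖ ≤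
      C * (eLpNorm f (ENNReal.ofReal p) μ).toReal *
        (eLpNorm g (ENNReal.ofReal p.conjExponent) ν).toReal := by
  have hA' : MeasurableSet (A ∩ tsupport f) := hA.inter (isClosed_tsupport f).measurableSet
  have hB' : MeasurableSet (B ∩ tsupport g) := hB.inter (isClosed_tsupport g).measurableSet
  obtain ⟨a, ham, hac, haA, ha0⟩ := exists_monotone_isCompact_measure_sdiff_iUnion (μ := μ) hA'
    (ne_top_of_le_ne_top (IsCompact.measure_lt_top hf.2.2).ne (measure_mono Set.inter_subset_right))
  obtain ⟨b, hbm, hbc, hbB, hb0⟩ := exists_monotone_isCompact_measure_sdiff_iUnion (μ := ν) hB'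
    (ne_top_of_le_ne_top (IsCompact.measure_lt_top hg.2.2).ne (measure_mono Set.inter_subset_right))
  have key : ∀ (h : E → ℝ) (D : Set E) (d : ℕ → Set E), (∀ n, d n ⊆ D ∩ tsupport h) → ∀ x,
      x ∉ (D ∩ tsupport h) \ ⋃ n, d n → (⋃ n, d n).indicator h x = D.indicator h x := by
    intro h D d hd x hx
    by_cases hxd : x ∈ ⋃ n, d n
    · obtain ⟨n, hn⟩ := Set.mem_iUnion.1 hxd
      rw [Set.indicator_of_mem hxd, Set.indicator_of_mem (hd n hn).1]
    · rw [Set.indicator_of_notMem hxd]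
      by_cases hxD : x ∈ D
      · rw [Set.indicator_of_mem hxD, image_eq_zero_of_notMem_tsupport (f := h)]
        exact fun hxs => hx ⟨⟨hxD, hxs⟩, hxd⟩
      · rw [Set.indicator_of_notMem hxD]
  have e1 : ∀ᵐ z : E × E ∂(ν.prod μ), (⋃ n, a n).indicator f z.2 = A.indicator f z.2 := by
    have h : ∀ᵐ x ∂μ, (⋃ n, a n).indicator f x = A.indicator f x := by
      filter_upwards [measure_eq_zero_iff_ae_notMem.1 ha0] with x hx using key f A a haA x hx
    exact Measure.quasiMeasurePreserving_snd.ae h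
  have e2 : ∀ᵐ z : E × E ∂(ν.prod μ), (⋃ n, b n).indicator g z.1 = B.indicator g z.1 := by
    have h : ∀ᵐ x ∂ν, (⋃ n, b n).indicator g x = B.indicator g x := by
      filter_upwards [measure_eq_zero_iff_ae_notMem.1 hb0] with x hx using key g B b hbB x hx
    exact Measure.quasiMeasurePreserving_fst.ae h
  have hlim : Tendsto (fun n => ∫ z : E × E, ((a n).indicator f z.2 * (b n).indicator g z.1) •
      K z.1 z.2 ∂(ν.prod μ)) atTop
      (𝓝 (∫ z : E × E, (A.indicator f z.2 * B.indicator g z.1) • K z.1 z.2 ∂(ν.prod μ))) := by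
    refine tendsto_integral_of_dominated_convergence
      (fun z : E × E => ‖(f z.2 * g z.1) • K z.1 z.2‖) (fun n => ?_)
      (integrable_pairing_of_locallyIntegrable hK hf hg).norm (fun n => ae_of_all _ fun z => ?_) ?_
    · exact (integrable_pairing_of_locallyIntegrable hK (hf.indicator (hac n).measurableSet)
        (hg.indicator (hbc n).measurableSet)).aestronglyMeasurable
    · simp only [norm_smul, norm_mul]
      gcongr <;> exact norm_indicator_le_norm_self _ _
    · filter_upwards [e1, e2] with z h1 h2
      rw [← h1, ← h2]
      exact (((ham.tendsto_indicator a f z.2).mono_right (pure_le_nhds _)).mul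
        ((hbm.tendsto_indicator b g z.1).mono_right (pure_le_nhds _))).smul_const _
  refine le_of_tendsto' hlim.norm fun n => ?_
  refine (hC _ _ (hf.indicator (hac n).measurableSet) (hg.indicator (hbc n).measurableSet)
    ?_).trans ?_
  · have hsub : ∀ (h : E → ℝ) (d : Set E), IsCompact d → tsupport (d.indicator h) ⊆ d :=
      fun h d hd => closure_minimal Set.support_indicator_subset hd.isClosed
    obtain ⟨r, hr, hlt⟩ := Metric.exists_pos_forall_lt_edist (hac n) (hbc n).isClosed
      (hAB.mono ((haA n).trans Set.inter_subset_left) ((hbB n).trans Set.inter_subset_left))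
    refine ⟨r, by exact_mod_cast hr, fun x hx y hy => ?_⟩
    have := hlt x (hsub f _ (hac n) hx) y (hsub g _ (hbc n) hy)
    rw [edist_nndist] at this
    exact_mod_cast this.le
  · exact mul_le_mul (mul_le_mul_of_nonneg_left (toReal_eLpNorm_le_of_abs_le hf
      (fun x => norm_indicator_le_norm_self f x) _) C.2) (toReal_eLpNorm_le_of_abs_le hg
      (fun x => norm_indicator_le_norm_self g x) _) ENNReal.toReal_nonneg (by positivity)

/-- For kernels vanishing near the diagonal, a restricted bound extends to all test functions,
without separation of the supports. -/
lemma HasRestrictedBound.norm_integral_le (hC : HasRestrictedBound K p μ ν C)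
    (hK : LocallyIntegrable (fun z : E × E => K z.1 z.2) (ν.prod μ)) {r : ℝ} (hr : 0 < r)
    (h0 : ∀ s t, dist s t < r → K s t = 0) {f g : E → ℝ}
    (hf : IsTestFunction f) (hg : IsTestFunction g) :
    ‖∫ z : E × E, (f z.2 * g z.1) • K z.1 z.2 ∂(ν.prod μ)‖ ≤
      4 * C * (eLpNorm f (ENNReal.ofReal p) μ).toReal *
        (eLpNorm g (ENNReal.ofReal p.conjExponent) ν).toReal := by
  classical
  obtain ⟨n, ι, hι, hdist⟩ := exists_finite_index_of_isCompact hg.2.2 hr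
  set c : ℝ := C * (eLpNorm f (ENNReal.ofReal p) μ).toReal *
        (eLpNorm g (ENNReal.ofReal p.conjExponent) ν).toReal with hc
  let J := Fin n → Bool
  -- `S` runs over all sets of cells: `f` is kept on the cells in `S`, `g` on the others.
  let A : Finset J → Set E := fun S => ι ⁻¹' S
  have hA : ∀ S, MeasurableSet (A S) := fun S => hι _
  have hint : ∀ S : Finset J, Integrable (fun z : E × E =>
      ((A S).indicator f z.2 * (A S)ᶜ.indicator g z.1) • K z.1 z.2) (ν.prod μ) := fun S =>
    integrable_pairing_of_locallyIntegrable hK (hf.indicator (hA S)) (hg.indicator (hA S).compl)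
  have hpt : ∀ z : E × E, (4 : ℝ) • ∑ S : Finset J,
      ((A S).indicator f z.2 * (A S)ᶜ.indicator g z.1) • K z.1 z.2 =
        (2 : ℝ) ^ Fintype.card J • (f z.2 * g z.1) • K z.1 z.2 := by
    intro z
    by_cases hKz : K z.1 z.2 = 0
    · simp [hKz]
    by_cases hgz : g z.1 = 0
    · simp [hgz, Set.indicator]
    have hne : ι z.2 ≠ ι z.1 := fun h => hKz (h0 _ _ (hdist z.1
      (subset_tsupport g hgz) z.2 h.symm))
    -- Where the integrand is nonzero the two points lie in different cells, so exactly a quarter of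
    -- the sets `S` retain it.
    rw [← Finset.sum_smul, smul_smul, smul_smul]
    congr 1
    have : ∀ S : Finset J, (A S).indicator f z.2 * (A S)ᶜ.indicator g z.1 =
        if ι z.2 ∈ S ∧ ι z.1 ∉ S then f z.2 * g z.1 else 0 := by
      intro S
      by_cases h1 : ι z.2 ∈ S <;> by_cases h2 : ι z.1 ∈ S <;>
        simp [Set.indicator, A, h1, h2]
    rw [Finset.sum_congr rfl fun S _ => this S, ← Finset.sum_filter, Finset.sum_const,
      nsmul_eq_mul, ← mul_assoc]
    congr 1
    exact_mod_cast four_mul_card_filter_mem_notMem hne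
  have hsum : (2 : ℝ) ^ Fintype.card J • ∫ z : E × E, (f z.2 * g z.1) • K z.1 z.2 ∂(ν.prod μ) =
      (4 : ℝ) • ∑ S : Finset J, ∫ z : E × E,
        ((A S).indicator f z.2 * (A S)ᶜ.indicator g z.1) • K z.1 z.2 ∂(ν.prod μ) := by
    rw [← integral_smul, ← integral_finsetSum _ fun S _ => hint S, ← integral_smul]
    exact integral_congr_ae (ae_of_all _ fun z => (hpt z).symm)
  have hle : (2 : ℝ) ^ Fintype.card J *
      ‖∫ z : E × E, (f z.2 * g z.1) • K z.1 z.2 ∂(ν.prod μ)‖ ≤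
      2 ^ Fintype.card J * (4 * c) := by
    calc _ = ‖(2 : ℝ) ^ Fintype.card J •
          ∫ z : E × E, (f z.2 * g z.1) • K z.1 z.2 ∂(ν.prod μ)‖ := by simp [norm_smul]
      _ ≤ 4 * ∑ S : Finset J, c := by
          rw [hsum, norm_smul, Real.norm_of_nonneg (by norm_num : (0 : ℝ) ≤ 4)]
          gcongr
          refine (norm_sum_le _ _).trans (Finset.sum_le_sum fun S _ => ?_)
          exact hC.norm_integral_indicator_le hK hf hg (hA S) (hA S).compl disjoint_compl_right
      _ = 2 ^ Fintype.card J * (4 * c) := by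
          rw [Finset.sum_const, Finset.card_univ, Fintype.card_finset, nsmul_eq_mul]
          push_cast
          ring
  refine (le_of_mul_le_mul_left hle (by positivity)).trans_eq ?_
  rw [hc]
  ring

end Pairing

open scoped FourierTransform ContDiff InnerProductSpace

/-! ### Smooth functions of `t - s` as Schur multipliers. -/

section Multipliers

variable {E : Type*} [NormedAddCommGroup E] [InnerProductSpace ℝ E] [FiniteDimensional ℝ E]
  [MeasurableSpace E] [BorelSpace E]
variable {F : Type*} [NormedAddCommGroup F] [NormedSpace ℝ F]
variable {G : Type*} [NormedAddCommGroup G] [NormedSpace ℝ G]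
variable {K : E → E → F} {p : ℝ} {μ ν : Measure E} [IsLocallyFiniteMeasure μ]
  [IsLocallyFiniteMeasure ν] {C : ℝ≥0}

/-- Fourier inversion for smooth compactly supported functions, in real form. -/
lemma exists_cos_sin_representation {Φ : E → ℝ} (hΦ : ContDiff ℝ ∞ Φ)
    (hc : HasCompactSupport Φ) :
    ∃ a b : E → ℝ, Continuous a ∧ Continuous b ∧ Integrable a ∧ Integrable b ∧
      ∀ x, Φ x = ∫ ξ, (Real.cos (2 * Real.pi * ⟪ξ, x⟫_ℝ) * a ξ -
        Real.sin (2 * Real.pi * ⟪ξ, x⟫_ℝ) * b ξ) := by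
  have hs : HasCompactSupport fun x => (Φ x : ℂ) := hc.comp_left (g := Complex.ofReal) rfl
  let S : SchwartzMap E ℂ := hs.toSchwartzMap (Complex.ofRealCLM.contDiff.comp hΦ)
  let w : SchwartzMap E ℂ := 𝓕 S
  have hw : Integrable w := w.integrable
  refine ⟨fun ξ => (w ξ).re, fun ξ => (w ξ).im, Complex.continuous_re.comp w.continuous,
    Complex.continuous_im.comp w.continuous, hw.re, hw.im, fun x => ?_⟩
  have hinv : 𝓕⁻ (𝓕 (S : E → ℂ)) x = S x :=
    congrFun (S.continuous.fourierInv_fourier_eq S.integrable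
      (by rw [← SchwartzMap.fourier_coe]; exact hw)) x
  rw [Real.fourierInv_eq', ← SchwartzMap.fourier_coe] at hinv
  have hint : Integrable fun v => Complex.exp (↑(2 * Real.pi * ⟪v, x⟫_ℝ) * Complex.I) • w v := by
    refine hw.bdd_smul 1 (Continuous.aestronglyMeasurable
      (f := fun v => Complex.exp (↑(2 * Real.pi * ⟪v, x⟫_ℝ) * Complex.I)) (by fun_prop))
      (ae_of_all _ fun v => ?_)
    rw [Complex.norm_exp_ofReal_mul_I]
  have hre := congrArg Complex.re hinv
  rw [← Complex.reCLM_apply, ← Complex.reCLM.integral_comp_comm hint] at hre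
  have hSx : (S x).re = Φ x := Complex.ofReal_re (Φ x)
  rw [← hSx, ← hre]
  refine integral_congr_ae (ae_of_all _ fun v => ?_)
  simp only [Complex.reCLM_apply, smul_eq_mul, Complex.mul_re, Complex.exp_ofReal_mul_I_re,
    Complex.exp_ofReal_mul_I_im]

lemma HasRestrictedBound.norm_integral_modulated_le (hC : HasRestrictedBound K p μ ν C)
    {f g u v : E → ℝ} (hf : IsTestFunction f) (hg : IsTestFunction g)
    (hfg : HaveSeparatedSupports f g) (hu : Measurable u) (hv : Measurable v)
    (hu1 : ∀ x, |u x| ≤ 1) (hv1 : ∀ x, |v x| ≤ 1) :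
    ‖∫ z : E × E, ((f z.2 * u z.2) * (g z.1 * v z.1)) • K z.1 z.2 ∂(ν.prod μ)‖ ≤
      C * (eLpNorm f (ENNReal.ofReal p) μ).toReal *
        (eLpNorm g (ENNReal.ofReal p.conjExponent) ν).toReal := by
  obtain ⟨r, hr, hd⟩ := hfg
  have hle : ∀ {h w : E → ℝ}, (∀ x, |w x| ≤ 1) → ∀ x, |h x * w x| ≤ |h x| := fun hw x => by
    rw [abs_mul]
    exact mul_le_of_le_one_right (abs_nonneg _) (hw x)
  refine (hC _ _ (hf.mul hu hu1) (hg.mul hv hv1) ⟨r, hr, fun x hx y hy =>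
    hd x (tsupport_mul_subset hx) y (tsupport_mul_subset hy)⟩).trans ?_
  exact mul_le_mul (mul_le_mul_of_nonneg_left (toReal_eLpNorm_le_of_abs_le hf (hle hu1) _) C.2)
    (toReal_eLpNorm_le_of_abs_le hg (hle hv1) _) ENNReal.toReal_nonneg (by positivity)

/-- The addition formulas split the cosine and the sine of `θ t - θ s` into two products each, of
functions of `t` and of `s` bounded by 1. This gives four modulated pairings and the factor 2. -/
lemma HasRestrictedBound.norm_integral_trig_le (hK : IsSingularKernel K μ ν)
    (hC : HasRestrictedBound K p μ ν C) {f g : E → ℝ} (hf : IsTestFunction f)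
    (hg : IsTestFunction g) (hfg : HaveSeparatedSupports f g) (θ : E → ℝ) (hθ : Measurable θ)
    (a b : ℝ) :
    ‖∫ z : E × E, (Real.cos (θ z.2 - θ z.1) * a - Real.sin (θ z.2 - θ z.1) * b) •
      (f z.2 * g z.1) • K z.1 z.2 ∂(ν.prod μ)‖ ≤
      2 * (|a| + |b|) * (C * (eLpNorm f (ENNReal.ofReal p) μ).toReal *
        (eLpNorm g (ENNReal.ofReal p.conjExponent) ν).toReal) := by
  have hcm : Measurable fun x => Real.cos (θ x) := Real.measurable_cos.comp hθ
  have hsm : Measurable fun x => Real.sin (θ x) := Real.measurable_sin.comp hθ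
  have hc1 : ∀ x, |Real.cos (θ x)| ≤ 1 := fun x => Real.abs_cos_le_one _
  have hs1 : ∀ x, |Real.sin (θ x)| ≤ 1 := fun x => Real.abs_sin_le_one _
  set c := C * (eLpNorm f (ENNReal.ofReal p) μ).toReal *
    (eLpNorm g (ENNReal.ofReal p.conjExponent) ν).toReal
  have hint : ∀ {u v : E → ℝ}, Measurable u → Measurable v → (∀ x, |u x| ≤ 1) →
      (∀ x, |v x| ≤ 1) → Integrable (fun z : E × E =>
        ((f z.2 * u z.2) * (g z.1 * v z.1)) • K z.1 z.2) (ν.prod μ) := by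
    intro u v hu hv hu1 hv1
    obtain ⟨r, hr, hd⟩ := hfg
    exact hK.integrable_pairing (hf.mul hu hu1) (hg.mul hv hv1) ⟨r, hr, fun x hx y hy =>
      hd x (tsupport_mul_subset hx) y (tsupport_mul_subset hy)⟩
  have hexp : ∀ z : E × E, (Real.cos (θ z.2 - θ z.1) * a - Real.sin (θ z.2 - θ z.1) * b) •
      (f z.2 * g z.1) • K z.1 z.2 =
      a • ((f z.2 * Real.cos (θ z.2)) * (g z.1 * Real.cos (θ z.1))) • K z.1 z.2 +
      a • ((f z.2 * Real.sin (θ z.2)) * (g z.1 * Real.sin (θ z.1))) • K z.1 z.2 +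
      (-b) • ((f z.2 * Real.sin (θ z.2)) * (g z.1 * Real.cos (θ z.1))) • K z.1 z.2 +
      b • ((f z.2 * Real.cos (θ z.2)) * (g z.1 * Real.sin (θ z.1))) • K z.1 z.2 := by
    intro z
    rw [Real.cos_sub, Real.sin_sub]
    module
  have i1 := (hint hcm hcm hc1 hc1).smul a
  have i2 := (hint hsm hsm hs1 hs1).smul a
  have i3 := (hint hsm hcm hs1 hc1).smul (-b)
  have i4 := (hint hcm hsm hc1 hs1).smul b
  simp only [Pi.smul_def] at i1 i2 i3 i4
  simp_rw [hexp]
  rw [integral_add ((i1.fun_add i2).fun_add i3) i4, integral_add (i1.fun_add i2) i3, integral_add i1 i2]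
  simp only [integral_smul]
  have b1 := hC.norm_integral_modulated_le hf hg hfg hcm hcm hc1 hc1
  have b2 := hC.norm_integral_modulated_le hf hg hfg hsm hsm hs1 hs1
  have b3 := hC.norm_integral_modulated_le hf hg hfg hsm hcm hs1 hc1
  have b4 := hC.norm_integral_modulated_le hf hg hfg hcm hsm hc1 hs1
  refine (norm_add₄_le).trans ?_
  simp only [norm_smul, Real.norm_eq_abs, abs_neg]
  have := mul_le_mul_of_nonneg_left b1 (abs_nonneg a)
  have := mul_le_mul_of_nonneg_left b2 (abs_nonneg a)
  have := mul_le_mul_of_nonneg_left b3 (abs_nonneg b)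
  have := mul_le_mul_of_nonneg_left b4 (abs_nonneg b)
  linarith

/-- Multiplication by a dilated smooth compactly supported function of `t - s` preserves
restricted bounds, uniformly in the dilation. -/
lemma exists_forall_hasRestrictedBound_smul {Φ : E → ℝ} (hΦ : ContDiff ℝ ∞ Φ)
    (hc : HasCompactSupport Φ) : ∃ W : ℝ≥0, ∀ (F : Type _) [NormedAddCommGroup F]
      [NormedSpace ℝ F] [CompleteSpace F] (K : E → E → F) (p : ℝ) (μ ν : Measure E) [IsLocallyFiniteMeasure μ]
      [IsLocallyFiniteMeasure ν] (C : ℝ≥0), IsSingularKernel K μ ν →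
      HasRestrictedBound K p μ ν C → ∀ ε : ℝ,
      HasRestrictedBound (fun s t => Φ (ε⁻¹ • (t - s)) • K s t) p μ ν (W * C) := by
  obtain ⟨a, b, ha, hb, hai, hbi, hrep⟩ := exists_cos_sin_representation hΦ hc
  have hab : Integrable fun ξ => 2 * (|a ξ| + |b ξ|) := (hai.abs.add hbi.abs).const_mul 2
  -- The dilation `ε` only changes the phases, never the amplitudes `a` and `b`, so this constant
  -- serves every `ε`.
  refine ⟨Real.toNNReal (∫ ξ, 2 * (|a ξ| + |b ξ|)), ?_⟩
  intro F _ _ _ K p μ ν _ _ C hK hC ε f g hf hg hfg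
  set c := C * (eLpNorm f (ENNReal.ofReal p) μ).toReal *
    (eLpNorm g (ENNReal.ofReal p.conjExponent) ν).toReal with hcdef
  have hH := hK.integrable_pairing hf hg hfg
  let k : E × E → E → ℝ := fun z ξ => Real.cos (2 * Real.pi * ⟪ξ, ε⁻¹ • (z.2 - z.1)⟫_ℝ) * a ξ -
        Real.sin (2 * Real.pi * ⟪ξ, ε⁻¹ • (z.2 - z.1)⟫_ℝ) * b ξ
  have hk : Continuous (Function.uncurry k) := by
    simp only [k, Function.uncurry_def]
    fun_prop
  have hkle : ∀ z ξ, ‖k z ξ‖ ≤ ‖2 * (|a ξ| + |b ξ|)‖ := by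
    intro z ξ
    rw [Real.norm_of_nonneg (by positivity : 0 ≤ 2 * (|a ξ| + |b ξ|))]
    refine (norm_sub_le _ _).trans ?_
    simp only [Real.norm_eq_abs, abs_mul]
    have h1 := mul_le_of_le_one_left (abs_nonneg (a ξ))
      (Real.abs_cos_le_one (2 * Real.pi * ⟪ξ, ε⁻¹ • (z.2 - z.1)⟫_ℝ))
    have h2 := mul_le_of_le_one_left (abs_nonneg (b ξ))
      (Real.abs_sin_le_one (2 * Real.pi * ⟪ξ, ε⁻¹ • (z.2 - z.1)⟫_ℝ))
    linarith [abs_nonneg (a ξ), abs_nonneg (b ξ)]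
  have hint : Integrable (Function.uncurry fun (z : E × E) (ξ : E) =>
      k z ξ • (f z.2 * g z.1) • K z.1 z.2) ((ν.prod μ).prod volume) := by
    have hdom : Integrable (fun y : (E × E) × E => (2 * (|a y.2| + |b y.2|)) •
        (f y.1.2 * g y.1.1) • K y.1.1 y.1.2) ((ν.prod μ).prod volume) :=
      (hab.smul_prod hH).swap
    refine hdom.mono (hk.aestronglyMeasurable.smul hH.aestronglyMeasurable.comp_fst)
      (ae_of_all _ fun y => ?_)
    rw [Function.uncurry_def, norm_smul, norm_smul _ ((f y.1.2 * g y.1.1) • K y.1.1 y.1.2)]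
    exact mul_le_mul_of_nonneg_right (hkle _ _) (norm_nonneg _)
  have heq : ∫ z : E × E, (f z.2 * g z.1) • Φ (ε⁻¹ • (z.2 - z.1)) • K z.1 z.2 ∂(ν.prod μ) =
      ∫ ξ, ∫ z : E × E, k z ξ • (f z.2 * g z.1) • K z.1 z.2 ∂(ν.prod μ) := by
    rw [← integral_integral_swap hint]
    refine integral_congr_ae (ae_of_all _ fun z => ?_)
    dsimp only
    rw [integral_smul_const, ← hrep, smul_comm]
  rw [heq]
  refine (norm_integral_le_of_norm_le (hab.mul_const c) (ae_of_all _ fun ξ => ?_)).trans_eq ?_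
  -- The phase is linear in `x`, so its value at `t - s` is a difference of a function of `t` and
  -- one of `s`.
  · have := HasRestrictedBound.norm_integral_trig_le hK hC hf hg hfg
      (fun x => 2 * Real.pi * ⟪ξ, ε⁻¹ • x⟫_ℝ) (by fun_prop) (a ξ) (b ξ)
    simpa only [k, smul_sub, inner_sub_right, mul_sub] using this
  · rw [integral_mul_const, hcdef]
    push_cast
    rw [Real.coe_toNNReal _ (integral_nonneg fun ξ => by positivity)]
    ring

lemma IsSingularKernel.smul_of_continuous (hK : IsSingularKernel K μ ν) {φ : E × E → ℝ}
    (hφ : Continuous φ) {c : ℝ} (hc : ∀ z, |φ z| ≤ c) :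
    IsSingularKernel (fun s t => φ (s, t) • K s t) μ ν :=
  hK.of_norm_le (hφ.aestronglyMeasurable.smul hK.1) fun s t => by
    rw [norm_smul]
    exact mul_le_mul_of_nonneg_right (hc _) (norm_nonneg _)

lemma IsSingularKernel.clm_comp (hK : IsSingularKernel K μ ν) (T : F →L[ℝ] G) :
    IsSingularKernel (fun s t => T (K s t)) μ ν :=
  hK.of_norm_le (T.continuous.comp_aestronglyMeasurable hK.1) fun _ _ => T.le_opNorm _

lemma HasRestrictedBound.clm_comp [CompleteSpace F] [CompleteSpace G]
    (hK : IsSingularKernel K μ ν) (hC : HasRestrictedBound K p μ ν C) (T : F →L[ℝ] G) :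
    HasRestrictedBound (fun s t => T (K s t)) p μ ν (‖T‖₊ * C) := by
  intro f g hf hg hfg
  have := T.integral_comp_comm (hK.integrable_pairing hf hg hfg)
  simp only [map_smul] at this
  rw [this]
  refine (T.le_opNorm _).trans ?_
  push_cast
  rw [mul_assoc, mul_assoc, ← mul_assoc (C : ℝ)]
  exact mul_le_mul_of_nonneg_left (hC f g hf hg hfg) (norm_nonneg _)

lemma HasRestrictedBound.add {K' : E → E → F} {C' : ℝ≥0} (hK : IsSingularKernel K μ ν)
    (hK' : IsSingularKernel K' μ ν) (hC : HasRestrictedBound K p μ ν C)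
    (hC' : HasRestrictedBound K' p μ ν C') :
    HasRestrictedBound (fun s t => K s t + K' s t) p μ ν (C + C') := by
  intro f g hf hg hfg
  simp only [smul_add]
  rw [integral_add (hK.integrable_pairing hf hg hfg) (hK'.integrable_pairing hf hg hfg)]
  refine (norm_add_le _ _).trans ((add_le_add (hC f g hf hg hfg) (hC' f g hf hg hfg)).trans_eq ?_)
  push_cast
  ring

lemma IsSingularKernel.add {K' : E → E → F} (hK : IsSingularKernel K μ ν)
    (hK' : IsSingularKernel K' μ ν) : IsSingularKernel (fun s t => K s t + K' s t) μ ν :=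
  ⟨hK.1.add hK'.1, fun Q hQ hd => (hK.2 Q hQ hd).add (hK'.2 Q hQ hd)⟩

lemma IsSchurMultiplierWith.sum {n : ℕ} {M : Fin n → E → E → F →L[ℝ] G} {W : Fin n → ℝ≥0}
    (h : ∀ i, IsSchurMultiplierWith (M i) p μ ν (W i)) :
    IsSchurMultiplierWith (fun s t => ∑ i, M i s t) p μ ν (∑ i, W i) := by
  intro K C hK hC
  induction n with
  | zero =>
    have h0 : schurProduct (fun s t => ∑ i, M i s t) K = fun _ _ => 0 := by
      ext s t
      simp [schurProduct]
    rw [h0]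
    exact ⟨⟨aestronglyMeasurable_const, fun _ _ _ => MemLp.zero⟩, fun f g _ _ _ => by
      simp only [smul_zero, integral_zero, norm_zero]
      positivity⟩
  | succ n ih =>
    obtain ⟨h1, h2⟩ := ih fun i => h i.succ
    obtain ⟨h3, h4⟩ := h 0 K C hK hC
    have h0 : schurProduct (fun s t => ∑ i, M i s t) K = fun s t => schurProduct (M 0) K s t +
        schurProduct (fun s t => ∑ i : Fin n, M i.succ s t) K s t := by
      ext s t
      simp [schurProduct, Fin.sum_univ_succ]
    rw [h0, Fin.sum_univ_succ, add_mul]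
    exact ⟨h3.add h1, HasRestrictedBound.add h3 h1 h4 h2⟩

/-- Multiples of a fixed linear map by dilations of a smooth compactly supported function of
`t - s` are Schur multipliers, uniformly in the dilation. -/
lemma exists_forall_isSchurMultiplierWith [CompleteSpace F] [CompleteSpace G] {Φ : E → ℝ}
    (hΦ : ContDiff ℝ ∞ Φ) (hc : HasCompactSupport Φ) (T : F →L[ℝ] G) :
    ∃ W : ℝ≥0, ∀ (p : ℝ) (μ ν : Measure E) [IsLocallyFiniteMeasure μ] [IsLocallyFiniteMeasure ν]
      (ε : ℝ), IsSchurMultiplierWith (fun s t => Φ (ε⁻¹ • (t - s)) • T) p μ ν W := by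
  obtain ⟨W, hW⟩ := exists_forall_hasRestrictedBound_smul hΦ hc
  obtain ⟨c, hcb⟩ := hc.exists_bound_of_continuous hΦ.continuous
  refine ⟨W * ‖T‖₊, fun p μ ν _ _ ε K C hK hC => ⟨?_, ?_⟩⟩
  · exact (hK.clm_comp T).smul_of_continuous (φ := fun z => Φ (ε⁻¹ • (z.2 - z.1)))
      (hΦ.continuous.comp (by fun_prop)) fun z => hcb _
  · rw [mul_assoc]
    exact hW G _ p μ ν _ (hK.clm_comp T) (hC.clm_comp hK T) ε

end Multipliers

/-! ### From bilinear bounds to operator bounds. -/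

section Duality

variable {E : Type*} [NormedAddCommGroup E] [InnerProductSpace ℝ E] [FiniteDimensional ℝ E]
  [MeasurableSpace E] [BorelSpace E]

/-- Testing against Hölder's extremal function `sign k * |k| ^ (p - 1)` gives `I ≤ A * I ^ (1 / q)`
with `I = ∫ |k| ^ p`. Here `k` stands for a truncation of `h`, so that this extremal function is
itself a test function. -/
lemma IsTestFunction.eLpNorm_le_of_dual_bound {ν : Measure E} [IsLocallyFiniteMeasure ν]
    {p : ℝ} (hp : 1 < p) {k h : E → ℝ} (hk : IsTestFunction k) {A : ℝ} (hA0 : 0 ≤ A)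
    (hkh : ∀ᵐ x ∂ν, k x ≠ 0 → k x = h x)
    (hA : ∀ g : E → ℝ, IsTestFunction g →
      |∫ x, g x * h x ∂ν| ≤ A * (eLpNorm g (ENNReal.ofReal p.conjExponent) ν).toReal) :
    eLpNorm k (ENNReal.ofReal p) ν ≤ ENNReal.ofReal A := by
  have hpq : p.HolderConjugate p.conjExponent := Real.HolderConjugate.conjExponent hp
  set q := p.conjExponent
  let g : E → ℝ := fun x => SignType.sign (k x) * |k x| ^ (p - 1)
  have hgabs : ∀ x, |g x| = |k x| ^ (p - 1) := by
    intro x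
    rcases lt_trichotomy (k x) 0 with hx | hx | hx
    · simp [g, sign_neg hx, abs_of_nonneg (Real.rpow_nonneg (abs_nonneg (k x)) _)]
    · simp [g, hx, Real.zero_rpow (sub_pos.2 hp).ne']
    · simp [g, sign_pos hx, abs_of_nonneg (Real.rpow_nonneg (abs_nonneg (k x)) _)]
  have hg : IsTestFunction g := by
    obtain ⟨hkm, ⟨B, hB⟩, hks⟩ := hk
    refine ⟨?_, ⟨B ^ (p - 1), fun x => ?_⟩, hks.mono fun x hx h0 => hx ?_⟩
    · have hsgn : Measurable fun x => ((SignType.sign (k x) : SignType) : ℝ) := by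
        have : (fun x => ((SignType.sign (k x) : SignType) : ℝ)) = fun x =>
            if 0 < k x then (1 : ℝ) else if k x < 0 then -1 else 0 := by
          ext x
          rw [sign_apply]
          split_ifs <;> simp
        rw [this]
        exact Measurable.ite (measurableSet_lt measurable_const hkm) measurable_const
          (Measurable.ite (measurableSet_lt hkm measurable_const) measurable_const
            measurable_const)
      exact hsgn.mul (hkm.abs.pow_const _)
    · rw [hgabs]
      exact Real.rpow_le_rpow (abs_nonneg _) (hB x) (sub_pos.2 hp).le
    · simp [g, h0]
  set I := ∫ x, ‖k x‖ ^ p ∂ν with hI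
  have hI0 : 0 ≤ I := integral_nonneg fun x => by positivity
  have hgh : ∫ x, g x * h x ∂ν = I := by
    refine integral_congr_ae ?_
    filter_upwards [hkh] with x hx
    by_cases hx0 : k x = 0
    · simp [g, hx0, Real.zero_rpow hpq.ne_zero]
    · rw [← hx hx0, Real.norm_eq_abs]
      simp only [g]
      rw [mul_right_comm, sign_mul_self, ← Real.rpow_one_add' (abs_nonneg _) (by linarith)]
      congr 1
      ring
  have hkN : eLpNorm k (ENNReal.ofReal p) ν = ENNReal.ofReal (I ^ p⁻¹) := by
    rw [(hk.memLp _ ν).eLpNorm_eq_integral_rpow_norm (by simpa using hpq.pos) ENNReal.ofReal_ne_top,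
      ENNReal.toReal_ofReal hpq.nonneg]
  have hgN : (eLpNorm g (ENNReal.ofReal q) ν).toReal = I ^ q⁻¹ := by
    rw [(hg.memLp _ ν).eLpNorm_eq_integral_rpow_norm (by simpa using hpq.symm.pos)
      ENNReal.ofReal_ne_top, ENNReal.toReal_ofReal hpq.symm.nonneg, ENNReal.toReal_ofReal (by
        positivity), hI]
    congr 1
    refine integral_congr_ae (ae_of_all _ fun x => ?_)
    simp only [Real.norm_eq_abs]
    rw [hgabs, ← Real.rpow_mul (abs_nonneg _), hpq.sub_one_mul_conj]
  have hle := hA g hg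
  rw [hgh, hgN, abs_of_nonneg hI0] at hle
  rw [hkN]
  refine ENNReal.ofReal_le_ofReal ?_
  rcases hI0.eq_or_lt with h0 | hpos
  · rwa [← h0, Real.zero_rpow (inv_ne_zero hpq.ne_zero)]
  · refine le_of_mul_le_mul_right ?_ (Real.rpow_pos_of_pos hpos q⁻¹)
    rwa [← Real.rpow_add hpos, hpq.inv_add_inv_eq_one, Real.rpow_one]

/-- A function with bounded pairings against all test functions is in `L^p`. -/
lemma eLpNorm_le_of_dual_bound {ν : Measure E} [IsLocallyFiniteMeasure ν]
    {p : ℝ} (hp : 1 < p) {h : E → ℝ} (hm : AEStronglyMeasurable h ν) {A : ℝ} (hA0 : 0 ≤ A)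
    (hA : ∀ g : E → ℝ, IsTestFunction g →
      |∫ x, g x * h x ∂ν| ≤ A * (eLpNorm g (ENNReal.ofReal p.conjExponent) ν).toReal) :
    eLpNorm h (ENNReal.ofReal p) ν ≤ ENNReal.ofReal A := by
  set h' := hm.mk h
  have hm' : Measurable h' := hm.stronglyMeasurable_mk.measurable
  -- Cutting off both height and distance from the origin yields test functions converging pointwise
  -- to `h'`; Fatou's lemma then transfers the bound.
  let X : ℕ → Set E := fun n => {x | |h' x| ≤ n} ∩ Metric.closedBall 0 n
  have hX : ∀ n, MeasurableSet (X n) := fun n =>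
    (measurableSet_le hm'.abs measurable_const).inter Metric.isClosed_closedBall.measurableSet
  have htest : ∀ n, IsTestFunction ((X n).indicator h') := fun n => by
    refine ⟨hm'.indicator (hX n), ⟨n, fun x => ?_⟩,
      HasCompactSupport.intro (isCompact_closedBall 0 n) fun x hx =>
        Set.indicator_of_notMem (fun hx' => hx hx'.2) _⟩
    by_cases hx : x ∈ X n
    · rw [Set.indicator_of_mem hx]
      exact hx.1
    · simp [Set.indicator_of_notMem hx]
  rw [eLpNorm_congr_ae hm.ae_eq_mk]
  refine (Lp.eLpNorm_lim_le_liminf_eLpNorm (f := fun n => (X n).indicator h')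
    (fun n => (htest n).1.aestronglyMeasurable) h' (ae_of_all _ fun x => ?_)).trans ?_
  · refine tendsto_const_nhds.congr' ?_
    filter_upwards [tendsto_natCast_atTop_atTop.eventually_ge_atTop (|h' x|),
      tendsto_natCast_atTop_atTop.eventually_ge_atTop ‖x‖] with n h1 h2
    rw [Set.indicator_of_mem]
    exact ⟨h1, by simpa using h2⟩
  · have hle : ∀ n, eLpNorm ((X n).indicator h') (ENNReal.ofReal p) ν ≤ ENNReal.ofReal A := by
      intro n
      refine (htest n).eLpNorm_le_of_dual_bound hp hA0 ?_ hA
      filter_upwards [hm.ae_eq_mk] with x hx hne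
      rw [hx]
      exact Set.indicator_of_mem (Set.mem_of_indicator_ne_zero hne) _
    exact (liminf_le_liminf (Eventually.of_forall hle)).trans_eq (liminf_const _)

variable {F : Type*} [NormedAddCommGroup F] [InnerProductSpace ℝ F] [FiniteDimensional ℝ F]
variable {K : E → E → F} {p : ℝ} {μ ν : Measure E} [IsLocallyFiniteMeasure μ]
  [IsLocallyFiniteMeasure ν]

/-- Fubini needs a compactly supported `g`; indicators of the balls of radius `n` serve, and
countably many null sets are discarded. -/
lemma ae_integrable_smul_of_locallyIntegrable
    (hK : LocallyIntegrable (fun z : E × E => K z.1 z.2) (ν.prod μ)) {f : E → ℝ}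
    (hf : IsTestFunction f) : ∀ᵐ s ∂ν, Integrable (fun t => f t • K s t) μ := by
  have hn : ∀ n : ℕ, ∀ᵐ s ∂ν, s ∈ Metric.closedBall (0 : E) n →
      Integrable (fun t => f t • K s t) μ := by
    intro n
    have hg : IsTestFunction ((Metric.closedBall (0 : E) n).indicator fun _ => (1 : ℝ)) := by
      refine ⟨measurable_const.indicator Metric.isClosed_closedBall.measurableSet,
        ⟨1, fun x => (norm_indicator_le_norm_self (fun _ => (1 : ℝ)) x).trans
          norm_one.le⟩,
        HasCompactSupport.intro (isCompact_closedBall 0 n) fun x hx =>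
          Set.indicator_of_notMem hx _⟩
    filter_upwards [(integrable_pairing_of_locallyIntegrable hK hf hg).prod_right_ae] with s hs hsn
    simpa [Set.indicator_of_mem hsn] using hs
  filter_upwards [ae_all_iff.2 hn] with s hs
  obtain ⟨n, hn⟩ := exists_nat_ge ‖s‖
  exact hs n (by simpa using hn)

lemma aestronglyMeasurable_integral_smul
    (hK : LocallyIntegrable (fun z : E × E => K z.1 z.2) (ν.prod μ)) {f : E → ℝ}
    (hf : IsTestFunction f) : AEStronglyMeasurable (fun s => ∫ t, f t • K s t ∂μ) ν :=
  ((hf.1.comp measurable_snd).aestronglyMeasurable.smul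
    hK.aestronglyMeasurable).integral_prod_right'

/-- A bilinear bound on all test functions makes the integral operator bounded. -/
lemma eLpNorm_integral_smul_le (hp : 1 < p)
    (hK : LocallyIntegrable (fun z : E × E => K z.1 z.2) (ν.prod μ)) {D : ℝ≥0}
    (hD : ∀ f g : E → ℝ, IsTestFunction f → IsTestFunction g →
      ‖∫ z : E × E, (f z.2 * g z.1) • K z.1 z.2 ∂(ν.prod μ)‖ ≤
        D * (eLpNorm f (ENNReal.ofReal p) μ).toReal *
          (eLpNorm g (ENNReal.ofReal p.conjExponent) ν).toReal) {f : E → ℝ}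
    (hf : IsTestFunction f) :
    eLpNorm (fun s => ∫ t, f t • K s t ∂μ) (ENNReal.ofReal p) ν ≤
      (Module.finrank ℝ F * D : ℝ≥0) * eLpNorm f (ENNReal.ofReal p) μ := by
  set h : E → F := fun s => ∫ t, f t • K s t ∂μ with hh
  have hm : AEStronglyMeasurable h ν := aestronglyMeasurable_integral_smul hK hf
  -- Scalar duality is applied to each coordinate; adding the coordinates costs the factor
  -- `finrank`.
  let e := stdOrthonormalBasis ℝ F
  have hfin := (hf.memLp (ENNReal.ofReal p) μ).eLpNorm_ne_top
  have hcoord : ∀ i, eLpNorm (fun s => ⟪e i, h s⟫_ℝ) (ENNReal.ofReal p) ν ≤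
      D * eLpNorm f (ENNReal.ofReal p) μ := by
    intro i
    have hA := eLpNorm_le_of_dual_bound (ν := ν) hp (h := fun s => ⟪e i, h s⟫_ℝ)
      ((innerSL ℝ (e i)).continuous.comp_aestronglyMeasurable hm)
      (A := D * (eLpNorm f (ENNReal.ofReal p) μ).toReal) (by positivity) (fun g hg => ?_)
    · rwa [ENNReal.ofReal_mul D.coe_nonneg, ENNReal.ofReal_toReal hfin, ENNReal.ofReal_coe_nnreal] at hA
    · have hint := integrable_pairing_of_locallyIntegrable hK hf hg
      have hsm : ∀ s, ∫ t, (f t * g s) • K s t ∂μ = g s • h s := fun s => by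
        rw [hh, ← integral_smul]
        simp only [smul_smul, mul_comm]
      have hgh : Integrable (fun s => g s • h s) ν := by
        have := hint.integral_prod_left
        simpa only [hsm] using this
      have h1 : ∫ s, g s * ⟪e i, h s⟫_ℝ ∂ν =
          ⟪e i, ∫ z : E × E, (f z.2 * g z.1) • K z.1 z.2 ∂(ν.prod μ)⟫_ℝ := by
        rw [integral_prod _ hint]
        simp only [hsm]
        rw [← integral_inner hgh]
        simp only [inner_smul_right]
      rw [h1]
      refine (abs_real_inner_le_norm _ _).trans ?_
      rw [e.norm_eq_one, one_mul]
      exact hD f g hf hg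
  have hsum : h = ∑ i, fun s => ⟪e i, h s⟫_ℝ • e i := by
    ext s
    rw [Finset.sum_apply]
    exact (e.sum_repr' (h s)).symm
  rw [hsum]
  refine (eLpNorm_sum_le (fun i _ => ?_) (by simpa using hp.le)).trans ?_
  · exact ((innerSL ℝ (e i)).continuous.comp_aestronglyMeasurable hm).smul_const _
  · have : ∀ i, eLpNorm (fun s => ⟪e i, h s⟫_ℝ • e i) (ENNReal.ofReal p) ν ≤
        D * eLpNorm f (ENNReal.ofReal p) μ := fun i =>
      (eLpNorm_mono fun s => by simp [norm_smul, e.norm_eq_one]).trans (hcoord i)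
    refine (Finset.sum_le_sum fun i _ => this i).trans_eq ?_
    rw [Finset.sum_const, Finset.card_univ, Fintype.card_fin, nsmul_eq_mul]
    push_cast
    ring

end Duality

/-! ### Comparison of sharp and smooth truncations. -/

section Truncation

variable {E : Type*} [NormedAddCommGroup E] [InnerProductSpace ℝ E] [FiniteDimensional ℝ E]

lemma exists_contDiff_cutoff (E : Type*) [NormedAddCommGroup E] [InnerProductSpace ℝ E]
    [FiniteDimensional ℝ E] {a b : ℝ} (ha : 0 < a) (hab : a < b) :
    ∃ ψ : E → ℝ, ContDiff ℝ ∞ ψ ∧ HasCompactSupport ψ ∧ (∀ x, 0 ≤ ψ x) ∧ (∀ x, ψ x ≤ 1) ∧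
      (∀ x, ‖x‖ ≤ a → ψ x = 1) ∧ ∀ x, b ≤ ‖x‖ → ψ x = 0 := by
  let ψ : ContDiffBump (0 : E) := ⟨a, b, ha, hab⟩
  exact ⟨ψ, ψ.contDiff, ψ.hasCompactSupport, fun x => ψ.nonneg, fun x => ψ.le_one,
    fun x hx => ψ.one_of_mem_closedBall (by simpa using hx),
    fun x hx => ψ.zero_of_le_dist (by simpa using hx)⟩

lemma exists_contDiff_annular_cutoff (E : Type*) [NormedAddCommGroup E] [InnerProductSpace ℝ E]
    [FiniteDimensional ℝ E] {a b c d : ℝ} (ha : 0 < a) (hab : a < b) (hbc : b ≤ c) (hcd : c < d) :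
    ∃ φ : E → ℝ, ContDiff ℝ ∞ φ ∧ HasCompactSupport φ ∧ (∀ x, 0 ≤ φ x) ∧
      (∀ x, b ≤ ‖x‖ → ‖x‖ ≤ c → φ x = 1) ∧ ∀ x, φ x ≠ 0 → a < ‖x‖ ∧ ‖x‖ < d := by
  obtain ⟨ψ, hψ, hψc, hψ0, hψ1, hψa, hψb⟩ := exists_contDiff_cutoff E ha hab
  obtain ⟨χ, hχ, hχc, hχ0, hχ1, hχa, hχb⟩ := exists_contDiff_cutoff E
    (ha.trans_le (hab.le.trans hbc)) hcd
  refine ⟨fun x => χ x - ψ x, hχ.sub hψ, hχc.sub hψc, fun x => ?_, fun x h1 h2 => ?_,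
    fun x hx => ⟨?_, ?_⟩⟩
  · beta_reduce
    rcases le_total ‖x‖ c with h | h
    · rw [hχa x h]
      linarith [hψ1 x]
    · rw [hψb x (hbc.trans h)]
      linarith [hχ0 x]
  · beta_reduce
    rw [hχa x h2, hψb x h1, sub_zero]
  · by_contra h
    rw [not_lt] at h
    exact hx (by beta_reduce; rw [hψa x h, hχa x (h.trans (hab.le.trans hbc)), sub_self])
  · by_contra h
    rw [not_lt] at h
    exact hx (by beta_reduce; rw [hχb x h, hψb x ((hbc.trans hcd.le).trans h), sub_self])

variable [MeasurableSpace E] [BorelSpace E]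
variable {F : Type*} [NormedAddCommGroup F] [InnerProductSpace ℝ F] [FiniteDimensional ℝ F]
variable {G : Type*} [NormedAddCommGroup G] [InnerProductSpace ℝ G] [CompleteSpace G]
variable {K : E → E → F} {p : ℝ} {μ ν : Measure E} [IsLocallyFiniteMeasure μ]
  [IsLocallyFiniteMeasure ν]

/-- A bounded sectorial kernel behaves like a positive one: every kernel it dominates is
bounded. -/
lemma norm_integral_le_of_norm_le_sectorial {L : E → E → G} {R : E → E → F} {D : ℝ} {κ : ℝ}
    (hκ : 0 < κ) {x₀ : G} (hx₀ : ‖x₀‖ = 1)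
    (hL : LocallyIntegrable (fun z : E × E => L z.1 z.2) (ν.prod μ))
    (hsec : ∀ᵐ z : E × E ∂(ν.prod μ), κ * ‖L z.1 z.2‖ ≤ ⟪L z.1 z.2, x₀⟫_ℝ)
    (hD : ∀ f g : E → ℝ, IsTestFunction f → IsTestFunction g →
      ‖∫ z : E × E, (f z.2 * g z.1) • L z.1 z.2 ∂(ν.prod μ)‖ ≤
        D * (eLpNorm f (ENNReal.ofReal p) μ).toReal *
          (eLpNorm g (ENNReal.ofReal p.conjExponent) ν).toReal)
    (hR : ∀ᵐ z : E × E ∂(ν.prod μ), ‖R z.1 z.2‖ ≤ ‖L z.1 z.2‖)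
    {f g : E → ℝ} (hf : IsTestFunction f) (hg : IsTestFunction g) :
    ‖∫ z : E × E, (f z.2 * g z.1) • R z.1 z.2 ∂(ν.prod μ)‖ ≤
      κ⁻¹ * D * (eLpNorm f (ENNReal.ofReal p) μ).toReal *
          (eLpNorm g (ENNReal.ofReal p.conjExponent) ν).toReal := by
  -- The bound for `L` is used at `|f|` and `|g|`, which have the same norms. This is where a bound
  -- without separated supports or sign conditions is needed.
  have hint := integrable_pairing_of_locallyIntegrable hL hf.abs hg.abs
  have hint' : Integrable (fun z : E × E => κ⁻¹ * ⟪x₀, (|f z.2| * |g z.1|) • L z.1 z.2⟫_ℝ)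
      (ν.prod μ) := (hint.const_inner x₀).const_mul _
  refine (norm_integral_le_of_norm_le hint' ?_).trans ?_
  · filter_upwards [hsec, hR] with z h1 h2
    rw [norm_smul, norm_mul, Real.norm_eq_abs, Real.norm_eq_abs, inner_smul_right,
      real_inner_comm, mul_left_comm]
    refine mul_le_mul_of_nonneg_left (h2.trans ?_) (by positivity)
    rwa [← div_eq_inv_mul, le_div_iff₀' hκ]
  · rw [integral_const_mul, integral_inner hint, mul_assoc, mul_assoc, ← mul_assoc D]
    refine mul_le_mul_of_nonneg_left ?_ (inv_nonneg.2 hκ.le)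
    refine (real_inner_le_norm _ _).trans ?_
    rw [hx₀, one_mul]
    refine (hD _ _ hf.abs hg.abs).trans_eq ?_
    have hf' : eLpNorm (fun x => |f x|) (ENNReal.ofReal p) μ = eLpNorm f (ENNReal.ofReal p) μ :=
      eLpNorm_norm f
    have hg' : eLpNorm (fun x => |g x|) (ENNReal.ofReal p.conjExponent) ν =
      eLpNorm g (ENNReal.ofReal p.conjExponent) ν := eLpNorm_norm g
    rw [hf', hg', mul_assoc]

lemma norm_inv_smul_sub {r : ℝ} (hr : 0 < r) (s t : E) : ‖r⁻¹ • (t - s)‖ = dist s t / r := by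
  rw [norm_smul, norm_inv, Real.norm_of_nonneg hr.le, dist_eq_norm', div_eq_inv_mul]

lemma IsSingularKernel.truncate (hK : IsSingularKernel K μ ν) (ε : ℝ) :
    IsSingularKernel (fun s t => {t | ε < dist s t}.indicator (K s) t) μ ν := by
  have hS : MeasurableSet {z : E × E | ε < dist z.1 z.2} :=
    (isOpen_lt continuous_const (continuous_fst.dist continuous_snd)).measurableSet
  refine hK.of_norm_le (c := 1) (hK.1.indicator hS) fun s t => ?_
  rw [one_mul]
  exact norm_indicator_le_norm_self _ _

lemma IsSingularKernel.locallyIntegrable_truncate (hK : IsSingularKernel K μ ν) {ε : ℝ}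
    (hε : 0 < ε) : LocallyIntegrable
      (fun z : E × E => {t | ε < dist z.1 t}.indicator (K z.1) z.2) (ν.prod μ) :=
  (hK.truncate ε).locallyIntegrable hε fun s _ hst =>
    Set.indicator_of_notMem (s := {t | ε < dist s t}) (fun h => lt_asymm hst h) (K s)

/-- On the test functions, the sharply truncated kernels of a restrictedly bounded kernel with
sectorial multipliers are uniformly bounded. -/
lemma exists_forall_norm_integral_truncated_le (hK : IsSingularKernel K μ ν)
    (hb : IsRestrictedlyBounded K p μ ν) (hH : HasSectorialMultipliers K p μ ν) :
    ∃ D : ℝ≥0, ∀ ε : ℝ, 0 < ε → ∀ f g : E → ℝ, IsTestFunction f → IsTestFunction g →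
      ‖∫ z : E × E, (f z.2 * g z.1) • {t | ε < dist z.1 t}.indicator (K z.1) z.2 ∂(ν.prod μ)‖ ≤
        D * (eLpNorm f (ENNReal.ofReal p) μ).toReal *
          (eLpNorm g (ENNReal.ofReal p.conjExponent) ν).toReal := by
  obtain ⟨C, hC⟩ := hb
  obtain ⟨d, M, δ, κ, C₁, hδ, hκ, hM⟩ := hH
  -- In units of `ρ`, `ψ` falls from 1 to 0 between `1 - 3η` and `1 - 2η`, while `φ` equals 1 there
  -- and lives in `(1 - 4η, 1 - η)`. The choice of `η` puts this last shell inside the sectorial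
  -- annulus and away from the diagonal.
  obtain ⟨η, hη0, hη1, hηδ⟩ : ∃ η : ℝ, 0 < η ∧ η ≤ 1 / 10 ∧ 5 * η ≤ δ :=
    ⟨min (1 / 10) (δ / 5), by positivity, min_le_left _ _, by
      linarith [min_le_right (1 / 10) (δ / 5)]⟩
  obtain ⟨φ, hφ, hφc, hφ0, hφ1, hφs⟩ := exists_contDiff_annular_cutoff E
    (a := 1 - 4 * η) (b := 1 - 3 * η) (c := 1 - 2 * η) (d := 1 - η) (by linarith) (by linarith)
    (by linarith) (by linarith)
  obtain ⟨ψ, hψ, hψc, hψ0, hψ1, hψa, hψb⟩ := exists_contDiff_cutoff E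
    (a := 1 - 3 * η) (b := 1 - 2 * η) (by linarith) (by linarith)
  obtain ⟨Wφ, hWφ⟩ := exists_forall_isSchurMultiplierWith hφ hφc
    (ContinuousLinearMap.id ℝ (EuclideanSpace ℝ (Fin d)))
  -- `1 - ψ` is not compactly supported, so the smooth truncation is written as `K` plus the
  -- multiplier `-ψ` applied to `K`.
  obtain ⟨Wψ, hWψ⟩ := exists_forall_isSchurMultiplierWith hψ hψc (-ContinuousLinearMap.id ℝ F)
  refine ⟨4 * (C + Wψ * C) + Real.toNNReal κ⁻¹ * (4 * (Wφ * (C₁ * C))), fun ε hε f g hf hg => ?_⟩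
  have hc : 0 < 1 - 2 * η := by linarith
  -- This places the sharp cut `ε` at the outer edge of the shell on which `ψ` varies.
  set ρ := ε / (1 - 2 * η) with hρdef
  have hρ : 0 < ρ := div_pos hε hc
  have hερ : ε = (1 - 2 * η) * ρ := by rw [hρdef, mul_div_cancel₀ _ hc.ne']
  obtain ⟨hMS, ⟨x₀, hx₀, hsec⟩, hMK⟩ := hM ρ hρ
  obtain ⟨hL1, hL2⟩ := hMS K C hK hC
  obtain ⟨hL, hLC⟩ := hWφ p μ ν ρ _ _ hL1 hL2
  obtain ⟨hP, hPC⟩ := hWψ p μ ν ρ K C hK hC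
  set L := schurProduct (fun s t => φ (ρ⁻¹ • (t - s)) •
    ContinuousLinearMap.id ℝ (EuclideanSpace ℝ (Fin d))) (schurProduct (M ρ) K) with hLdef
  have hLapp : ∀ s t, L s t = φ (ρ⁻¹ • (t - s)) • schurProduct (M ρ) K s t := fun s t => rfl
  have hann : ∀ s t, φ (ρ⁻¹ • (t - s)) ≠ 0 → (s, t) ∈ annulus E δ ρ := by
    intro s t hst
    have h := hφs _ hst
    rw [norm_inv_smul_sub hρ, lt_div_iff₀ hρ, div_lt_iff₀ hρ] at h
    constructor
    · exact lt_of_le_of_lt (mul_le_mul_of_nonneg_right (by linarith) hρ.le) h.1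
    · exact h.2.trans_le (mul_le_of_le_one_left hρ.le (by linarith))
  have hL0 : ∀ s t, dist s t < (1 - 4 * η) * ρ → L s t = 0 := by
    intro s t hst
    rw [hLapp]
    by_contra h
    have h1 := (hφs _ (left_ne_zero_of_smul h)).1
    rw [norm_inv_smul_sub hρ, lt_div_iff₀ hρ] at h1
    exact h1.not_gt hst
  have hLloc := hL.locallyIntegrable (r := (1 - 4 * η) * ρ) (mul_pos (by linarith) hρ) hL0
  have hLb := fun f g hf hg => hLC.norm_integral_le hLloc (r := (1 - 4 * η) * ρ)
    (mul_pos (by linarith) hρ) hL0 (f := f) (g := g) hf hg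
  have hLsec : ∀ᵐ z : E × E ∂(ν.prod μ), κ * ‖L z.1 z.2‖ ≤ ⟪L z.1 z.2, x₀⟫_ℝ := by
    filter_upwards [hsec] with z hz
    rw [hLapp]
    by_cases h : φ (ρ⁻¹ • (z.2 - z.1)) = 0
    · simp [h]
    · rw [norm_smul, Real.norm_of_nonneg (hφ0 _), inner_smul_left, mul_left_comm]
      exact mul_le_mul_of_nonneg_left (hz (hann _ _ h)) (hφ0 _)
  set P : E → E → F := fun s t => K s t + schurProduct (fun s t => ψ (ρ⁻¹ • (t - s)) •
    -ContinuousLinearMap.id ℝ F) K s t with hPdef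
  have hPapp : ∀ s t, P s t = (1 - ψ (ρ⁻¹ • (t - s))) • K s t := fun s t => by
    change K s t + ψ (ρ⁻¹ • (t - s)) • -K s t = _
    rw [sub_smul, one_smul, smul_neg]
    exact (sub_eq_add_neg _ _).symm
  have hP' : IsSingularKernel P μ ν := hK.add hP
  have hP0 : ∀ s t, dist s t < (1 - 3 * η) * ρ → P s t = 0 := fun s t hst => by
    rw [hPapp, hψa, sub_self, zero_smul]
    rw [norm_inv_smul_sub hρ, div_le_iff₀ hρ]
    exact hst.le
  have hPloc := hP'.locallyIntegrable (r := (1 - 3 * η) * ρ) (mul_pos (by linarith) hρ) hP0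
  have hPb := (HasRestrictedBound.add hK hP hC hPC).norm_integral_le hPloc
    (r := (1 - 3 * η) * ρ) (mul_pos (by linarith) hρ) hP0 hf hg
  let T : E → E → F := fun s t => {t | ε < dist s t}.indicator (K s) t
  have hTloc : LocallyIntegrable (fun z : E × E => T z.1 z.2) (ν.prod μ) :=
    hK.locallyIntegrable_truncate hε
  -- Beyond `ε` both truncations equal `K`, and below `(1 - 3η)ρ` both vanish. In between they
  -- differ by at most `|K| ≤ |M_ρ K|`, and `φ = 1` there.
  have hR : ∀ᵐ z : E × E ∂(ν.prod μ), ‖T z.1 z.2 - P z.1 z.2‖ ≤ ‖L z.1 z.2‖ := by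
    filter_upwards [hMK] with ⟨s, t⟩ hz
    simp only [hLapp, hPapp, T] at hz ⊢
    have hx := norm_inv_smul_sub hρ s t
    by_cases hst : ε < dist s t
    · rw [Set.indicator_of_mem (by exact hst), hψb, sub_zero, one_smul, sub_self, norm_zero]
      · exact norm_nonneg _
      · rw [hx, le_div_iff₀ hρ, ← hερ]
        exact hst.le
    · rw [Set.indicator_of_notMem (by exact hst), zero_sub, norm_neg]
      rcases le_total ‖ρ⁻¹ • (t - s)‖ (1 - 3 * η) with h | h
      · rw [hψa _ h, sub_self, zero_smul, norm_zero]
        exact norm_nonneg _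
      · have h1 : φ (ρ⁻¹ • (t - s)) = 1 := hφ1 _ h (by
          rw [hx, div_le_iff₀ hρ, ← hερ]
          exact not_lt.1 hst)
        rw [h1, one_smul, norm_smul, Real.norm_of_nonneg (by linarith [hψ1 (ρ⁻¹ • (t - s))])]
        refine (mul_le_of_le_one_left (norm_nonneg _)
          (by linarith [hψ0 (ρ⁻¹ • (t - s))])).trans (hz (hann s t ?_))
        rw [h1]
        exact one_ne_zero
  have hRb := norm_integral_le_of_norm_le_sectorial (R := fun s t => T s t - P s t) hκ hx₀ hLloc
    hLsec hLb hR hf hg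
  have hsplit : ∫ z : E × E, (f z.2 * g z.1) • T z.1 z.2 ∂(ν.prod μ) =
      ∫ z : E × E, (f z.2 * g z.1) • P z.1 z.2 ∂(ν.prod μ) +
        ∫ z : E × E, (f z.2 * g z.1) • (T z.1 z.2 - P z.1 z.2) ∂(ν.prod μ) := by
    rw [← integral_add (integrable_pairing_of_locallyIntegrable hPloc hf hg)
      (integrable_pairing_of_locallyIntegrable (K := fun s t => T s t - P s t)
        (hTloc.sub hPloc) hf hg)]
    simp only [← smul_add, add_sub_cancel]
  change ‖∫ z : E × E, (f z.2 * g z.1) • T z.1 z.2 ∂(ν.prod μ)‖ ≤ _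
  rw [hsplit]
  refine (norm_add_le _ _).trans ((add_le_add hPb hRb).trans_eq ?_)
  push_cast
  rw [Real.coe_toNNReal _ (inv_nonneg.2 hκ.le)]
  ring

/-- Restrictedly bounded singular kernels with sectorial multipliers have uniformly bounded
truncations. -/
theorem truncationsUniformlyBounded (hp : 1 < p) (hK : IsSingularKernel K μ ν)
    (hb : IsRestrictedlyBounded K p μ ν) (hH : HasSectorialMultipliers K p μ ν) :
    TruncationsUniformlyBounded K p μ ν := by
  obtain ⟨D, hD⟩ := exists_forall_norm_integral_truncated_le hK hb hH
  refine ⟨Module.finrank ℝ F * D, fun ε hε f hf => ?_⟩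
  have hloc := hK.locallyIntegrable_truncate hε
  have hS : ∀ s, MeasurableSet {t : E | ε < dist s t} := fun s =>
    (isOpen_lt continuous_const (continuous_const.dist continuous_id)).measurableSet
  have hind : ∀ s, (fun t => f t • {t | ε < dist s t}.indicator (K s) t) =
      {t | ε < dist s t}.indicator fun t => f t • K s t := fun s => by
    ext t
    exact (Set.indicator_smul_apply _ f (K s) t).symm
  have hT : truncatedOperator K μ ε f = fun s =>
      ∫ t, f t • {t | ε < dist s t}.indicator (K s) t ∂μ := by
    ext s
    rw [hind, integral_indicator (hS s)]
    rfl
  have hle := eLpNorm_integral_smul_le (K := fun s t => {t | ε < dist s t}.indicator (K s) t)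
    hp hloc (hD ε hε) hf
  refine ⟨?_, ?_, ?_⟩
  · filter_upwards [ae_integrable_smul_of_locallyIntegrable
      (K := fun s t => {t | ε < dist s t}.indicator (K s) t) hloc hf] with s hs
    rwa [hind, integrable_indicator_iff (hS s)] at hs
  · rw [hT]
    exact ⟨aestronglyMeasurable_integral_smul
      (K := fun s t => {t | ε < dist s t}.indicator (K s) t) hloc hf, hle.trans_lt
      (ENNReal.mul_lt_top ENNReal.coe_lt_top (hf.memLp _ μ).eLpNorm_lt_top)⟩
  · rw [hT]
    exact hle

end Truncation

/-! ### The Riesz, Cauchy and Ahlfors–Beurling kernels. -/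

section Examples

variable {E : Type*} [NormedAddCommGroup E] [InnerProductSpace ℝ E] [FiniteDimensional ℝ E]
  [MeasurableSpace E] [BorelSpace E]
variable {F : Type*} [NormedAddCommGroup F] [InnerProductSpace ℝ F] [FiniteDimensional ℝ F]
variable {K : E → E → F} {p : ℝ} {μ ν : Measure E} [IsLocallyFiniteMeasure μ]
  [IsLocallyFiniteMeasure ν]

/-- Kernels continuous off the diagonal are singular kernels. -/
lemma isSingularKernel_of_continuousOn
    (hK : ContinuousOn (fun z : E × E => K z.1 z.2) (Set.diagonal E)ᶜ)
    (h0 : ∀ s, K s s = 0) : IsSingularKernel K μ ν := by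
  have hS : MeasurableSet (Set.diagonal E)ᶜ := isClosed_diagonal.isOpen_compl.measurableSet
  have hm : AEStronglyMeasurable (fun z : E × E => K z.1 z.2) (ν.prod μ) := by
    -- Vanishing on the diagonal makes the kernel equal to its restriction to the complement, so
    -- continuity there gives measurability everywhere.
    have : (fun z : E × E => K z.1 z.2) =
        (Set.diagonal E)ᶜ.indicator fun z : E × E => K z.1 z.2 := by
      ext ⟨s, t⟩
      by_cases h : s = t
      · simp [h, h0]
      · rw [Set.indicator_of_mem (by simpa using h)]
    rw [this, aestronglyMeasurable_indicator_iff hS]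
    exact hK.aestronglyMeasurable hS
  refine ⟨hm, fun Q hQ hd => ?_⟩
  have : IsFiniteMeasure ((ν.prod μ).restrict Q) := ⟨by simpa using hQ.measure_lt_top⟩
  obtain ⟨B, hB⟩ := hQ.exists_bound_of_continuousOn (hK.mono hd.subset_compl_right)
  exact MemLp.of_bound hm.restrict B
    ((ae_restrict_iff' hQ.measurableSet).2 (ae_of_all _ fun z hz => hB z hz))

/-- A kernel has sectorial multipliers if a smooth compactly supported vector field has a large
inner product with it, at all scales. -/
lemma hasSectorialMultipliers_of_inner {A : E → F} (hA : ContDiff ℝ ∞ A)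
    (hc : HasCompactSupport A) (h : ∀ ε : ℝ, 0 < ε → ∀ s t, ε / 2 < dist s t → dist s t < ε →
      ‖K s t‖ ≤ ⟪A (ε⁻¹ • (t - s)), K s t⟫_ℝ) : HasSectorialMultipliers K p μ ν := by
  let e := stdOrthonormalBasis ℝ F
  let u : EuclideanSpace ℝ (Fin 1) := EuclideanSpace.single 0 1
  have hu : ‖u‖ = 1 := by simp [u]
  have hW := fun i => exists_forall_isSchurMultiplierWith (Φ := fun x => ⟪e i, A x⟫_ℝ)
    (contDiff_const.inner ℝ hA) (hc.comp_left (g := fun y => ⟪e i, y⟫_ℝ) (inner_zero_right _))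
    ((innerSL ℝ (e i)).smulRight u)
  choose W hW using hW
  -- Pairing with `A` is expanded in an orthonormal basis, so each summand is a scalar cutoff times
  -- a fixed rank-one map.
  let M : ℝ → E → E → F →L[ℝ] EuclideanSpace ℝ (Fin 1) := fun ε s t =>
    ∑ i, ⟪e i, A (ε⁻¹ • (t - s))⟫_ℝ • (innerSL ℝ (e i)).smulRight u
  have hM : ∀ ε s t, schurProduct (M ε) K s t = ⟪A (ε⁻¹ • (t - s)), K s t⟫_ℝ • u := by
    intro ε s t
    rw [← e.sum_inner_mul_inner, Finset.sum_smul]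
    simp only [schurProduct, M, sum_apply, smul_apply,
      ContinuousLinearMap.smulRight_apply, innerSL_apply_apply, smul_smul]
    refine Finset.sum_congr rfl fun i _ => ?_
    rw [real_inner_comm]
  -- With a one-dimensional target the product is a nonnegative multiple of `u` on the annulus,
  -- hence sectorial with `κ = 1`.
  refine ⟨1, M, 1 / 2, 1, ∑ i, W i, by norm_num, one_pos, fun ε hε =>
    ⟨IsSchurMultiplierWith.sum fun i => hW i p μ ν ε, ⟨u, hu, ae_of_all _ fun z hz => ?_⟩,
      ae_of_all _ fun z hz => ?_⟩⟩
  all_goals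
    have hle := h ε hε z.1 z.2 (by linarith [hz.1]) hz.2
    have h0 := (norm_nonneg _).trans hle
    simp only [hM]
    rw [norm_smul, hu, mul_one, Real.norm_of_nonneg h0]
  · rw [inner_smul_left, real_inner_self_eq_norm_sq, hu]
    simp
  · exact hle

end Examples

lemma isSingularKernel_rieszKernel (N : ℕ) (α : ℝ) (μ ν : Measure (EuclideanSpace ℝ (Fin N)))
    [IsLocallyFiniteMeasure μ] [IsLocallyFiniteMeasure ν] :
    IsSingularKernel (rieszKernel N α) μ ν := by
  refine isSingularKernel_of_continuousOn ?_ fun s => by simp [rieszKernel]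
  have hne : ∀ z ∈ (Set.diagonal (EuclideanSpace ℝ (Fin N)))ᶜ, ‖z.2 - z.1‖ ≠ 0 := fun z hz =>
    norm_ne_zero_iff.2 (sub_ne_zero.2 (Ne.symm hz))
  have hc : Continuous fun z : EuclideanSpace ℝ (Fin N) × EuclideanSpace ℝ (Fin N) =>
    z.2 - z.1 := continuous_snd.sub continuous_fst
  refine ContinuousOn.smul (ContinuousOn.inv₀ (hc.norm.continuousOn.rpow_const fun z hz =>
    Or.inl (hne z hz)) fun z hz => ?_) hc.continuousOn
  exact (Real.rpow_pos_of_pos ((norm_nonneg _).lt_of_ne' (hne z hz)) _).ne'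

/-- The kernel is a positive multiple of `t - s`, so pairing it with `2x`, `x = (t - s) / ε`, gives
`2 |x| |K|`, which is at least `|K|` when `|x| > 1/2`. -/
lemma hasSectorialMultipliers_rieszKernel (N : ℕ) (α p : ℝ)
    (μ ν : Measure (EuclideanSpace ℝ (Fin N))) [IsLocallyFiniteMeasure μ]
    [IsLocallyFiniteMeasure ν] : HasSectorialMultipliers (rieszKernel N α) p μ ν := by
  obtain ⟨ψ, hψ, hψc, -, -, hψ1, -⟩ :=
    exists_contDiff_cutoff (EuclideanSpace ℝ (Fin N)) one_pos one_lt_two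
  have hA : ContDiff ℝ ∞ fun x => (2 * ψ x) • x := (contDiff_const.mul hψ).smul contDiff_id
  have hc : HasCompactSupport fun x => (2 * ψ x) • x :=
    hψc.mono fun x hx h0 => hx (by beta_reduce; rw [h0, mul_zero, zero_smul])
  refine hasSectorialMultipliers_of_inner hA hc fun ε hε s t h1 h2 => ?_
  have hx := norm_inv_smul_sub hε s t
  have h1' : 1 / 2 < ‖ε⁻¹ • (t - s)‖ := by
    rw [hx, lt_div_iff₀ hε]
    linarith
  beta_reduce
  rw [hψ1 _ (by rw [hx, div_le_one hε]; exact h2.le), rieszKernel]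
  simp only [inner_smul_left, inner_smul_right, real_inner_self_eq_norm_sq, norm_smul] at h1' ⊢
  rw [norm_inv, Real.norm_of_nonneg hε.le] at h1'
  rw [Real.norm_of_nonneg (by positivity)]
  simp only [mul_one, conj_trivial]
  have h3 : 0 ≤ (‖t - s‖ ^ (α + 1))⁻¹ * ‖t - s‖ := by positivity
  nlinarith [mul_nonneg h3 (sub_nonneg.2 h1'.le)]

lemma isSingularKernel_cauchyKernel (μ ν : Measure ℂ) [IsLocallyFiniteMeasure μ]
    [IsLocallyFiniteMeasure ν] : IsSingularKernel cauchyKernel μ ν := by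
  -- The convention `1 / 0 = 0` supplies the zero value on the diagonal.
  refine isSingularKernel_of_continuousOn ?_ fun s => by simp [cauchyKernel]
  exact continuousOn_const.div (continuous_snd.sub continuous_fst).continuousOn fun z hz =>
    sub_ne_zero.2 (Ne.symm hz)

lemma isSingularKernel_ahlforsBeurlingKernel (μ ν : Measure ℂ) [IsLocallyFiniteMeasure μ]
    [IsLocallyFiniteMeasure ν] : IsSingularKernel ahlforsBeurlingKernel μ ν := by
  refine isSingularKernel_of_continuousOn ?_ fun s => by simp [ahlforsBeurlingKernel]
  exact continuousOn_const.div ((continuous_snd.sub continuous_fst).pow 2).continuousOn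
    fun z hz => pow_ne_zero 2 (sub_ne_zero.2 (Ne.symm hz))

/-- The conjugate of a power of `x`, cut off at infinity, is sectorial for the inverse power. -/
lemma hasSectorialMultipliers_inv_pow (n : ℕ) (p : ℝ) (μ ν : Measure ℂ)
    [IsLocallyFiniteMeasure μ] [IsLocallyFiniteMeasure ν] :
    HasSectorialMultipliers (fun s t : ℂ => 1 / (t - s) ^ n) p μ ν := by
  obtain ⟨ψ, hψ, hψc, -, -, hψ1, -⟩ := exists_contDiff_cutoff ℂ one_pos one_lt_two
  have hA : ContDiff ℝ ∞ fun x => (2 ^ n * ψ x) • (starRingEnd ℂ) (x ^ n) :=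
    (contDiff_const.mul hψ).smul (Complex.conjCLE.contDiff.comp (contDiff_id.pow n))
  have hc : HasCompactSupport fun x => (2 ^ n * ψ x) • (starRingEnd ℂ) (x ^ n) :=
    hψc.mono fun x hx h0 => hx (by beta_reduce; rw [h0, mul_zero, zero_smul])
  refine hasSectorialMultipliers_of_inner hA hc fun ε hε s t h1 h2 => ?_
  have hx := norm_inv_smul_sub hε s t
  have hd : 0 < dist s t := (half_pos hε).trans h1
  have hne : t - s ≠ 0 := sub_ne_zero.2 (dist_pos.1 hd).symm
  have hpow : (t - s) ^ n ≠ 0 := pow_ne_zero n hne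
  rw [hψ1 _ (by rw [hx, div_le_one hε]; exact h2.le)]
  -- The real inner product conjugates its first argument back, so `x ^ n` cancels the kernel and
  -- leaves the constant `(2 / ε) ^ n`. It dominates `|t - s|⁻ⁿ` because `|t - s| > ε / 2`.
  have hin : ⟪(2 ^ n * (1 : ℝ)) • (starRingEnd ℂ) ((ε⁻¹ • (t - s)) ^ n), 1 / (t - s) ^ n⟫_ℝ =
      (2 * ε⁻¹) ^ n := by
    rw [inner_smul_left, smul_pow, Complex.inner, Complex.conj_conj, mul_smul_comm,
      one_div_mul_cancel hpow, Complex.smul_re, Complex.one_re, mul_pow]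
    simp
  rw [hin, norm_div, norm_one, norm_pow, ← dist_eq_norm', ← one_div_pow]
  refine pow_le_pow_left₀ (by positivity) ?_ n
  rw [div_le_iff₀ hd, ← div_eq_mul_inv, div_mul_eq_mul_div, le_div_iff₀ hε]
  linarith

end SingularKernels

theorem proposition4p2 :
    (∀ (N k : ℕ) (p : ℝ) (μ ν : Measure (EuclideanSpace ℝ (Fin N)))
      [IsLocallyFiniteMeasure μ] [IsLocallyFiniteMeasure ν]
      (K : EuclideanSpace ℝ (Fin N) → EuclideanSpace ℝ (Fin N) → EuclideanSpace ℝ (Fin k)),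
      1 < p → SingularKernels.NoCommonAtoms μ ν →
      SingularKernels.IsSingularKernel K μ ν →
      SingularKernels.IsRestrictedlyBounded K p μ ν →
      SingularKernels.HasSectorialMultipliers K p μ ν →
      SingularKernels.TruncationsUniformlyBounded K p μ ν) ∧
    (∀ (N : ℕ) (α p : ℝ) (μ ν : Measure (EuclideanSpace ℝ (Fin N)))
      [IsLocallyFiniteMeasure μ] [IsLocallyFiniteMeasure ν],
      0 < α → 1 < p → SingularKernels.NoCommonAtoms μ ν →
      SingularKernels.IsSingularKernel (SingularKernels.rieszKernel N α) μ ν ∧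
      SingularKernels.HasSectorialMultipliers (SingularKernels.rieszKernel N α) p μ ν ∧
      (SingularKernels.IsRestrictedlyBounded (SingularKernels.rieszKernel N α) p μ ν →
        SingularKernels.TruncationsUniformlyBounded (SingularKernels.rieszKernel N α) p μ ν)) ∧
    (∀ (p : ℝ) (μ ν : Measure ℂ) [IsLocallyFiniteMeasure μ] [IsLocallyFiniteMeasure ν],
      1 < p → SingularKernels.NoCommonAtoms μ ν →
      ∀ K : ℂ → ℂ → ℂ,
        K = SingularKernels.cauchyKernel ∨ K = SingularKernels.ahlforsBeurlingKernel →
        SingularKernels.IsSingularKernel K μ ν ∧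
        SingularKernels.HasSectorialMultipliers K p μ ν ∧
        (SingularKernels.IsRestrictedlyBounded K p μ ν →
          SingularKernels.TruncationsUniformlyBounded K p μ ν)) := by

  refine ⟨?_, ?_, ?_⟩
  · intro N k p μ ν _ _ K hp _ hK hb hH
    exact SingularKernels.truncationsUniformlyBounded hp hK hb hH
  · intro N α p μ ν _ _ _ hp _
    have hK := SingularKernels.isSingularKernel_rieszKernel N α μ ν
    have hH := SingularKernels.hasSectorialMultipliers_rieszKernel N α p μ ν
    exact ⟨hK, hH, fun hb => SingularKernels.truncationsUniformlyBounded hp hK hb hH⟩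
  · intro p μ ν _ _ hp _ K hKc
    have hK : SingularKernels.IsSingularKernel K μ ν := by
      rcases hKc with rfl | rfl
      · exact SingularKernels.isSingularKernel_cauchyKernel μ ν
      · exact SingularKernels.isSingularKernel_ahlforsBeurlingKernel μ ν
    have hH : SingularKernels.HasSectorialMultipliers K p μ ν := by
      rcases hKc with rfl | rfl
      · have h := SingularKernels.hasSectorialMultipliers_inv_pow 1 p μ ν
        simp only [pow_one] at h
        exact h
      · exact SingularKernels.hasSectorialMultipliers_inv_pow 2 p μ ν
    exact ⟨hK, hH, fun hb => SingularKernels.truncationsUniformlyBounded hp hK hb hH⟩
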